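/- **Model.** An arm has true states $1,\dots,M$, a stochastic transition matrix $(p_{kj})$, a stochastic observation matrix $(\varepsilon_{ij})$, rewards $r_{ij}$ (true state $i$, observed state $j$), and feedback probabilities $\rho_{kl}=P(F=l\mid S=k)$, $1\le l\le L$. For a belief $\omega$ in the simplex put $R_\omega=\sum_i\omega_i\sum_j\varepsilon_{ij}r_{ij}$. If the arm is passive the belief moves to $\mathcal B_0\omega=\omega P$. If it is active, feedback $l$ occurs with probability $q_l(\omega)=\sum_k\rho_{kl}\omega_k$ and the belief moves to $\mathcal B_l\omega=\big(\sum_k p_{kj}\rho_{kl}\omega_k/q_l(\omega)\big)_j$ (put $\mathcal B_l\omega=\omega P$ if $q_l(\omega)=0$). Fix an initial belief $\omega_0$; let $S=\Omega(\omega_0)$ be the countable set of all $\mathcal B_{l_1}\cdots\mathcal B_{l_T}\omega_0$, $T\ge 0$, and let $p^1_{ij},p^0_{ij}$ be the transition probabilities on $S$ under the active and the passive action. Let $0\le\beta<1$. In the two-arm problem with subsidy $\lambda\in\mathbb R$ one chooses in each slot $t=0,1,\dots$ between activating the arm at its current belief $\omega(t)$ ($a(t)=1$, expected reward $R_{\omega(t)}$)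 and activating an auxiliary arm with a single state $0$ ($a(t)=0$, reward $\lambda$; the original arm is then passive). Policies may be randomized and may depend on the past beliefs and actions of the original arm. The aim is to maximize the expected total $\beta$-discounted reward. For a policy $\pi$ and an initial state $j\in S$ let $x^1_\omega(\pi,j)=\mathbb E_\pi[\sum_t\beta^t\mathbf 1(\omega(t)=\omega,a(t)=1)\mid\omega(0)=j]$ and $x^1_0(\pi,j)=\mathbb E_\pi[\sum_t\beta^t\mathbf 1(a(t)=0)\mid\omega(0)=j]$. For $\Omega\subseteq S$ let $T^\Omega_j$ and $R^\Omega_j$ be the expected total discounted active time of, and reward from, the original arm started at $j$ when it is active exactly in the states of $\Omega$, and put $$A^\Omega_i=1+\beta\sum_j(p^1_{ij}-p^0_{ij})T^{\Omega^c}_j,\qquad W^\Omega_i=R_i+\beta\sum_j(p^1_{ij}-p^0_{ij})R^{\Omega^c}_j,$$ $b_j(\Omega)=\inf_\pi\sum_{\omega\in\Omega}A^\Omega_\omega x^1_\omega(\pi,j)$ and $b_j(\{0\}\cup\Omega)=\inf_\pi\big(x^1_0(\pi,j)+\sum_{\omega\in\Omega}A^\Omega_\omega x^1_\omega(\pi,j)\big)$.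 **PCL-indexability.** Let $\tilde\Omega$ be a family of subsets of $S$ with $S\in\tilde\Omega$. The partial conservation law (PCL) w.r.t. $\tilde\Omega$ says that for all $\Omega\in\tilde\Omega$, all policies $\pi$ and all initial states $j$: $x^1_0(\pi,j)+\sum_{\omega\in\Omega}A^\Omega_\omega x^1_\omega(\pi,j)\ge b_j(\{0\}\cup\Omega)$, with equality if $\pi$ gives priority to $\Omega^c$ over $0$ (the arm is always activated in $\Omega^c$); $\sum_{\omega\in\Omega}A^\Omega_\omega x^1_\omega(\pi,j)\ge b_j(\Omega)$, with equality if $\pi$ gives priority to $0$ over $\Omega$ (the arm is never activated in $\Omega$); and $x^1_0(\pi,j)+\sum_{\omega\in S}x^1_\omega(\pi,j)=b_j(\{0\}\cup S)$. A full subset chain of $\tilde\Omega$ is a family $C=(\Omega^C_i)_{i\in S}$ of members of $\tilde\Omega$ such that $i\in\Omega^C_i$ for all $i$, and for $i\ne j$ either $\Omega^C_i\subsetneq\Omega^C_j$ or $\Omega^C_j\subsetneq\Omega^C_i$, where $\Omega^C_i\subsetneq\Omega^C_j$ implies $j\notin\Omega^C_i$. The arm is PCL-indexable w.r.t. $\tilde\Omega$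 if PCL holds w.r.t. $\tilde\Omega$ and there is exactly one full subset chain $C$ of $\tilde\Omega$ such that the numbers $\lambda_i=W_i^{\Omega^C_i}/A_i^{\Omega^C_i}$ are well defined (nonzero denominators) and $\Omega^C_i\subsetneq\Omega^C_j$ implies $\lambda_i<\lambda_j$. An RMAB, i.e. a finite collection of such arms, each with its own $\omega_0$ and $\tilde\Omega$, is PCL-indexable if each of its arms is. **Whittle index.** The passive set $\mathcal P(\lambda)$ of an arm consists of the states $i\in S$ from which some optimal policy of the problem with subsidy $\lambda$ starts with the passive action. The arm is Whittle indexable if $\mathcal P(\lambda)$ is nondecreasing in $\lambda$, empty for all sufficiently small $\lambda$ and equal to $S$ for all sufficiently large $\lambda$; the Whittle index of $i$ is then $\inf\{\lambda:i\in\mathcal P(\lambda)\}$. An RMAB is Whittle indexable if each of its arms is. **Theorem 3.** Suppose that the RMAB is PCL-indexable and that for each arm the family $(\lambda_i)_{i\in S}$ has only finitely many limit points in $\mathbb R$. Then for each arm: 1. for every subsidy $\lambda$, every priority policy given by the indices $(\lambda_i)_{i\in S}$ and the index $\lambda$ of the auxiliary state (activate the original arm in states with $\lambda_i>\lambda$,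 the auxiliary arm in states with $\lambda_i<\lambda$, break ties arbitrarily) is optimal for the two-arm problem from every initial state in $S$; 2. the arm is Whittle indexable (hence so is the RMAB), and $\lambda_i$ is the Whittle index of the belief state $i$, for every $i\in S$. -/

import Mathlib

open scoped Matrix

/-- A matrix with nonnegative entries all of whose rows sum to one. -/
def IsStochastic {m n : ℕ} (A : Matrix (Fin m) (Fin n) ℝ) : Prop :=
  (∀ i j, 0 ≤ A i j) ∧ ∀ i, ∑ j, A i j = 1

/-- The belief simplex over `M` true states. -/
abbrev Belief (M : ℕ) : Type := stdSimplex ℝ (Fin M)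

/-- A partially observable arm with `M` true states and `L` feedback states. -/
structure POArm (M L : ℕ) where
  /-- transition matrix of the true state -/
  P : Matrix (Fin M) (Fin M) ℝ
  /-- `E i j` is the probability of observing `j` when the true state is `i` -/
  E : Matrix (Fin M) (Fin M) ℝ
  /-- `r i j` is the reward when the true state is `i` and the observed state is `j` -/
  r : Matrix (Fin M) (Fin M) ℝ
  /-- `ρ i l` is the probability of the feedback `l` when the true state is `i` -/
  ρ : Matrix (Fin M) (Fin L) ℝ
  stochastic_P : IsStochastic P
  stochastic_E : IsStochastic E
  stochastic_ρ : IsStochastic ρ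

noncomputable section

namespace POArm

variable {M L : ℕ} (X : POArm M L)

/-- Expected immediate reward of the active action at belief `ω`. -/
def reward (ω : Belief M) : ℝ := ∑ i, ω.1 i * ∑ j, X.E i j * X.r i j

/-- Probability of the feedback `l` when the arm is activated at belief `ω`. -/
def feedbackProb (ω : Belief M) (l : Fin L) : ℝ := ∑ k, X.ρ k l * ω.1 k

theorem feedbackProb_nonneg (ω : Belief M) (l : Fin L) : 0 ≤ X.feedbackProb ω l :=
  Finset.sum_nonneg fun k _ => mul_nonneg (X.stochastic_ρ.1 k l) (ω.2.1 k)

theorem sum_feedbackProb (ω : Belief M) : ∑ l, X.feedbackProb ω l = 1 := by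
  unfold feedbackProb
  rw [Finset.sum_comm]
  simp_rw [← Finset.sum_mul, X.stochastic_ρ.2, one_mul]
  exact ω.2.2

/-- Belief update under the passive action: `ω ↦ ω P`. -/
def passiveUpdate (ω : Belief M) : Belief M :=
  ⟨ω.1 ᵥ* X.P, by
    simp only [stdSimplex, Set.mem_ofPred_eq, Matrix.vecMul, dotProduct]
    refine ⟨fun j => Finset.sum_nonneg fun k _ => mul_nonneg (ω.2.1 k) (X.stochastic_P.1 k j), ?_⟩
    rw [Finset.sum_comm]
    simp_rw [← Finset.mul_sum, X.stochastic_P.2, mul_one]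
    exact ω.2.2⟩

open Classical in
/-- Belief update under the active action with feedback `l`, by Bayes' rule. When the feedback `l`
has probability zero, so that it never occurs, the value is by convention `ω P`; in this way such
feedbacks create no new belief states. -/
def activeUpdate (l : Fin L) (ω : Belief M) : Belief M :=
  if h : X.feedbackProb ω l = 0 then X.passiveUpdate ω
  else ⟨fun j => (∑ k, X.P k j * X.ρ k l * ω.1 k) / X.feedbackProb ω l, by
    refine ⟨fun j => div_nonneg (Finset.sum_nonneg fun k _ =>
      mul_nonneg (mul_nonneg (X.stochastic_P.1 k j) (X.stochastic_ρ.1 k l)) (ω.2.1 k))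
      (X.feedbackProb_nonneg ω l), ?_⟩
    rw [← Finset.sum_div, Finset.sum_comm]
    simp_rw [← Finset.sum_mul, X.stochastic_P.2, one_mul]
    exact div_self h⟩

/-- The update operators: `none` is the passive one, `some l` the active one with feedback `l`. -/
def update : Option (Fin L) → Belief M → Belief M
  | none => X.passiveUpdate
  | some l => X.activeUpdate l

/-- The belief state space generated by `ω₀`: all beliefs obtained from `ω₀` by finitely many
updates. -/
def beliefSpace (ω₀ : Belief M) : Set (Belief M) :=
  {ω | ∃ w : List (Option (Fin L)), w.foldr X.update ω₀ = ω}

/-- The states of the belief process started in `ω₀`. -/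
abbrev State (ω₀ : Belief M) : Type := X.beliefSpace ω₀

variable {ω₀ : Belief M}

/-- The update operators act on the belief state space. -/
def stateUpdate (o : Option (Fin L)) (s : X.State ω₀) : X.State ω₀ :=
  ⟨X.update o s.1, by
    obtain ⟨w, hw⟩ := s.2
    exact ⟨o :: w, by rw [List.foldr_cons, hw]⟩⟩

/-- The law of the feedback when the arm is activated at belief `ω`. -/
def feedbackLaw (ω : Belief M) : PMF (Fin L) :=
  PMF.ofFintype (fun l => ENNReal.ofReal (X.feedbackProb ω l)) (by
    rw [← ENNReal.ofReal_sum_of_nonneg fun l _ => X.feedbackProb_nonneg ω l,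
      X.sum_feedbackProb, ENNReal.ofReal_one])

/-- Law of the next belief state; the action `true` is active, `false` is passive. -/
def trans : Bool → X.State ω₀ → PMF (X.State ω₀)
  | true, s => (X.feedbackLaw s.1).map fun l => X.stateUpdate (some l) s
  | false, s => PMF.pure (X.stateUpdate none s)

/-- Transition probabilities of the belief state under the two actions. -/
def p (a : Bool) (i j : X.State ω₀) : ℝ := (X.trans a i j).toReal

/-- An admissible policy of the two-arm system: given the past belief states and actions (most
recent first) and the current belief state of the original arm, it chooses, possibly at random,
whether the original arm (`true`) or the auxiliary arm (`false`) is activated. -/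
abbrev Policy (ω₀ : Belief M) : Type := List (X.State ω₀ × Bool) → X.State ω₀ → PMF Bool

/-- Joint law of the past before time `t` and of the belief state at time `t`, under the policy `π`
and from the initial state `i`. -/
def historyLaw (π : X.Policy ω₀) (i : X.State ω₀) :
    ℕ → PMF (List (X.State ω₀ × Bool) × X.State ω₀)
  | 0 => PMF.pure ([], i)
  | t + 1 => (historyLaw π i t).bind fun z => (π z.1 z.2).bind fun a =>
      (X.trans a z.2).map fun s => ((z.2, a) :: z.1, s)

/-- Law of the belief state and the action at time `t`. -/
def stateActionLaw (π : X.Policy ω₀) (i : X.State ω₀) (t : ℕ) : PMF (X.State ω₀ × Bool) :=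
  (X.historyLaw π i t).bind fun z => (π z.1 z.2).map fun a => (z.2, a)

/-- `E_π[∑ₜ βᵗ f(ω(t), a(t)) | ω(0) = i]`, for bounded `f`. -/
def discounted (β : ℝ) (π : X.Policy ω₀) (i : X.State ω₀) (f : X.State ω₀ × Bool → ℝ) : ℝ :=
  ∑' t : ℕ, β ^ t * ∑' z, (X.stateActionLaw π i t z).toReal * f z

open Classical in
/-- The performance measure `x_ω^a(π, i)` of the belief state `ω`. -/
def x (β : ℝ) (a : Bool) (ω : X.State ω₀) (π : X.Policy ω₀) (i : X.State ω₀) : ℝ :=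
  X.discounted β π i fun z => if z = (ω, a) then 1 else 0

/-- The performance measure `x_0^1(π, i)` of the auxiliary arm, which is activated exactly when the
original arm is passive. -/
def xAux (β : ℝ) (π : X.Policy ω₀) (i : X.State ω₀) : ℝ :=
  X.discounted β π i fun z => if z.2 = false then 1 else 0

/-- Expected total discounted time during which the original arm is active. -/
def activeTime (β : ℝ) (π : X.Policy ω₀) (i : X.State ω₀) : ℝ :=
  X.discounted β π i fun z => if z.2 = true then 1 else 0

/-- Expected total discounted reward from the original arm. -/
def armReward (β : ℝ) (π : X.Policy ω₀) (i : X.State ω₀) : ℝ :=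
  X.discounted β π i fun z => if z.2 = true then X.reward z.1 else 0

/-- Expected total discounted reward of the two-arm problem: the auxiliary arm pays the subsidy
`lam` whenever it is activated, that is, whenever the original arm is passive. -/
def value (β lam : ℝ) (π : X.Policy ω₀) (i : X.State ω₀) : ℝ :=
  X.discounted β π i fun z => if z.2 = true then X.reward z.1 else lam

open Classical in
/-- The `Ω`-priority policy: the original arm is active exactly in the states of `Ω`. -/
def priorityPolicy (Ω : Set (X.State ω₀)) : X.Policy ω₀ := fun _ s => PMF.pure (decide (s ∈ Ω))

/-- The coefficient `A_i^Ω`. -/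
def coeffA (β : ℝ) (Ω : Set (X.State ω₀)) (i : X.State ω₀) : ℝ :=
  1 + β * ∑' j, (X.p true i j - X.p false i j) * X.activeTime β (X.priorityPolicy Ωᶜ) j

/-- The coefficient `W_i^Ω`. -/
def coeffW (β : ℝ) (Ω : Set (X.State ω₀)) (i : X.State ω₀) : ℝ :=
  X.reward i.1 +
    β * ∑' j, (X.p true i j - X.p false i j) * X.armReward β (X.priorityPolicy Ωᶜ) j

/-- `∑_{ω ∈ Ω} A_ω^Ω x_ω^1(π, i)`. -/
def weightedSum (β : ℝ) (Ω : Set (X.State ω₀)) (π : X.Policy ω₀) (i : X.State ω₀) : ℝ :=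
  ∑' ω : Ω, X.coeffA β Ω ω * X.x β true ω.1 π i

/-- `b(Ω)`, for the initial state `i`. -/
def bound (β : ℝ) (Ω : Set (X.State ω₀)) (i : X.State ω₀) : ℝ :=
  ⨅ π : X.Policy ω₀, X.weightedSum β Ω π i

/-- `b({0} ∪ Ω)`, for the initial state `i`. -/
def boundAux (β : ℝ) (Ω : Set (X.State ω₀)) (i : X.State ω₀) : ℝ :=
  ⨅ π : X.Policy ω₀, (X.xAux β π i + X.weightedSum β Ω π i)

/-- The policy gives priority to the states of `Ω` over the auxiliary state. -/
def PriorityOverAux (π : X.Policy ω₀) (Ω : Set (X.State ω₀)) : Prop :=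
  ∀ h, ∀ s ∈ Ω, π h s = PMF.pure true

/-- The policy gives priority to the auxiliary state over the states of `Ω`. -/
def AuxPriorityOver (π : X.Policy ω₀) (Ω : Set (X.State ω₀)) : Prop :=
  ∀ h, ∀ s ∈ Ω, π h s = PMF.pure false

/-- The partial conservation law with respect to the family `F` of sets of belief states. -/
structure PartialConservationLaw (β : ℝ) (F : Set (Set (X.State ω₀))) : Prop where
  le_aux : ∀ Ω ∈ F, ∀ π i, X.boundAux β Ω i ≤ X.xAux β π i + X.weightedSum β Ω π i
  le : ∀ Ω ∈ F, ∀ π i, X.bound β Ω i ≤ X.weightedSum β Ω π i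
  total : ∀ (π : X.Policy ω₀) (i : X.State ω₀), X.xAux β π i + ∑' ω, X.x β true ω π i =
    X.boundAux β Set.univ i
  eq_aux : ∀ Ω ∈ F, ∀ π i, X.PriorityOverAux π Ωᶜ →
    X.xAux β π i + X.weightedSum β Ω π i = X.boundAux β Ω i
  eq : ∀ Ω ∈ F, ∀ π i, X.AuxPriorityOver π Ω → X.weightedSum β Ω π i = X.bound β Ω i

/-- `C` is a full subset chain of `F`. -/
structure IsFullSubsetChain (F : Set (Set (X.State ω₀))) (C : X.State ω₀ → Set (X.State ω₀)) :
    Prop where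
  mem_family : ∀ i, C i ∈ F
  self_mem : ∀ i, i ∈ C i
  total : ∀ i j, i ≠ j → C i ⊂ C j ∨ C j ⊂ C i
  not_mem : ∀ i j, i ≠ j → C i ⊂ C j → j ∉ C i

/-- The index `λ_i^C = W_i / A_i`, both coefficients being taken for the set `C i`. -/
def chainIndex (β : ℝ) (C : X.State ω₀ → Set (X.State ω₀)) (i : X.State ω₀) : ℝ :=
  X.coeffW β (C i) i / X.coeffA β (C i) i

/-- `C` is a full subset chain of `F` whose indices are well defined and strictly increase along
the chain. -/
structure IsIndexChain (β : ℝ) (F : Set (Set (X.State ω₀))) (C : X.State ω₀ → Set (X.State ω₀)) :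
    Prop where
  chain : X.IsFullSubsetChain F C
  denom_ne_zero : ∀ i, X.coeffA β (C i) i ≠ 0
  strict : ∀ i j, i ≠ j → C i ⊂ C j → X.chainIndex β C i < X.chainIndex β C j

/-- PCL-indexability with respect to the family `F`, which contains the whole state space. -/
structure PCLIndexable (β : ℝ) (F : Set (Set (X.State ω₀))) : Prop where
  univ_mem : Set.univ ∈ F
  pcl : X.PartialConservationLaw β F
  existsUnique_chain : ∃! C : X.State ω₀ → Set (X.State ω₀), X.IsIndexChain β F C

/-- The family of reals `idx` has only finitely many limit points; a limit point is a real each of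
whose neighbourhoods contains `idx i` for infinitely many `i`. -/
def FinitelyManyLimitPoints {ι : Type*} (idx : ι → ℝ) : Prop :=
  {v : ℝ | MapClusterPt v Filter.cofinite idx}.Finite

/-- `π` maximizes the expected total discounted reward of the two-arm problem from `i`. -/
def IsOptimalFrom (β lam : ℝ) (π : X.Policy ω₀) (i : X.State ω₀) : Prop :=
  ∀ π' : X.Policy ω₀, X.value β lam π' i ≤ X.value β lam π i

/-- `π` is a priority policy for the index `idx` in the two-arm problem, the auxiliary state having
the index `lam`: the arm whose state has the larger index is activated (ties are broken
arbitrarily). -/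
def IsIndexPriorityPolicy (idx : X.State ω₀ → ℝ) (lam : ℝ) (π : X.Policy ω₀) : Prop :=
  X.PriorityOverAux π {s | lam < idx s} ∧ X.AuxPriorityOver π {s | idx s < lam}

/-- The passive set: the states in which being passive is an optimal choice under the subsidy
`lam`. -/
def passiveSet (β : ℝ) (ω₀ : Belief M) (lam : ℝ) : Set (X.State ω₀) :=
  {i | ∃ π : X.Policy ω₀, π [] i = PMF.pure false ∧ X.IsOptimalFrom β lam π i}

/-- Whittle indexability of the arm: the passive set increases from the empty set to the whole state
space as the subsidy increases from `-∞` to `+∞`. -/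
structure WhittleIndexable (β : ℝ) (ω₀ : Belief M) : Prop where
  mono : Monotone (X.passiveSet β ω₀)
  eventually_empty : ∀ᶠ lam in Filter.atBot, X.passiveSet β ω₀ lam = ∅
  eventually_univ : ∀ᶠ lam in Filter.atTop, X.passiveSet β ω₀ lam = Set.univ

/-- `w` is the Whittle index of the state `i`: the infimum of the subsidies for which `i` lies in
the passive set. -/
def IsWhittleIndex (β : ℝ) (i : X.State ω₀) (w : ℝ) : Prop :=
  IsGLB {lam : ℝ | i ∈ X.passiveSet β ω₀ lam} w

end POArm

/-- A restless bandit is Whittle indexable if each of its decoupled single-arm problems is. -/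
def RMABWhittleIndexable {N : ℕ} {M L : Fin N → ℕ} (arm : ∀ n, POArm (M n) (L n)) (β : ℝ)
    (ω₀ : ∀ n, Belief (M n)) : Prop :=
  ∀ n, (arm n).WhittleIndexable β (ω₀ n)

end

/-! Fix a state `i`. For a subsidy λ let `D_λ` be the set of states of index above λ, and let `g(λ)`
be the advantage in `i` of acting now over resting now, when the arm is afterwards active exactly in
`D_λ`. For a frozen active set this advantage is affine in λ, of the form `W - λ A`, where `A` is
the marginal active time and `W` the marginal reward. Everything follows from three facts about `g`.

It is continuous (`continuous_gap`). The active set changes at λ only in states of index λ, and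
there the advantage is zero because the index is the quotient `W / A`. Such a change affects no
value, and values depend continuously on the active set.

It is antitone (`antitone_gap`). Just to the right of a λ that is not a limit point of the indices,
`D_λ` is constant and `g` has slope `-A ≤ 0`. The sign of `A` is all that is needed from the
conservation law (`PartialConservationLaw.coeffA_nonneg`). Continuity carries monotonicity across
the exceptional points.

It vanishes at the index of `i`. So resting never has an advantage in `D_λ`, and acting never has
one outside. Since the reward of any policy is that of the `D_λ`-policy plus the advantages
collected by its deviations (`discounted_eq_add_deviation`), the `D_λ`-policy is optimal.

For the passive set `g` must moreover be strictly positive below the index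
(`gap_subsidizedReward_pos`). Otherwise `g` would be zero on an interval ending at the index, and
the slope there, hence the denominator of the index, would be zero. -/

noncomputable section

/-! ### Bounded functions and expectations under discrete laws -/

/-- A real function that is bounded in absolute value. -/
def IsBdd {α : Type*} (f : α → ℝ) : Prop := ∃ B, ∀ z, |f z| ≤ B

namespace IsBdd

variable {α γ : Type*} {f g : α → ℝ}

theorem const (c : ℝ) : IsBdd fun _ : α => c := ⟨|c|, fun _ => le_rfl⟩

theorem add (hf : IsBdd f) (hg : IsBdd g) : IsBdd fun z => f z + g z := by
  obtain ⟨B, hB⟩ := hf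
  obtain ⟨B', hB'⟩ := hg
  exact ⟨B + B', fun z => (abs_add_le _ _).trans (add_le_add (hB z) (hB' z))⟩

theorem const_mul (c : ℝ) (hf : IsBdd f) : IsBdd fun z => c * f z := by
  obtain ⟨B, hB⟩ := hf
  exact ⟨|c| * B, fun z => by rw [abs_mul]; exact mul_le_mul_of_nonneg_left (hB z) (abs_nonneg c)⟩

theorem neg (hf : IsBdd f) : IsBdd fun z => -f z := by
  obtain ⟨B, hB⟩ := hf
  exact ⟨B, fun z => by rw [abs_neg]; exact hB z⟩

theorem sub (hf : IsBdd f) (hg : IsBdd g) : IsBdd fun z => f z - g z := by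
  simpa only [sub_eq_add_neg] using hf.add hg.neg

theorem comp (hf : IsBdd f) (e : γ → α) : IsBdd fun z => f (e z) := by
  obtain ⟨B, hB⟩ := hf
  exact ⟨B, fun z => hB (e z)⟩

theorem ite (hf : IsBdd f) (hg : IsBdd g) (P : α → Prop) [DecidablePred P] :
    IsBdd fun z => if P z then f z else g z := by
  obtain ⟨B, hB⟩ := hf
  obtain ⟨B', hB'⟩ := hg
  refine ⟨max B B', fun z => ?_⟩
  dsimp only
  split_ifs
  · exact (hB z).trans (le_max_left _ _)
  · exact (hB' z).trans (le_max_right _ _)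

end IsBdd

namespace PMF

variable {α γ : Type*}

/-- The expectation of a real function under a discrete probability law. -/
def expect (μ : PMF α) (f : α → ℝ) : ℝ := ∑' z, (μ z).toReal * f z

theorem summable_toReal (μ : PMF α) : Summable fun z => (μ z).toReal :=
  ENNReal.summable_toReal μ.tsum_coe_ne_top

theorem tsum_toReal (μ : PMF α) : ∑' z, (μ z).toReal = 1 := by
  rw [← ENNReal.tsum_toReal_eq fun z => μ.apply_ne_top z, μ.tsum_coe, ENNReal.toReal_one]

theorem summable_mul (μ : PMF α) {f : α → ℝ} (hf : IsBdd f) :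
    Summable fun z => (μ z).toReal * f z := by
  obtain ⟨B, hB⟩ := hf
  refine Summable.of_norm_bounded (μ.summable_toReal.mul_right B) fun z => ?_
  rw [Real.norm_eq_abs, abs_mul, abs_of_nonneg ENNReal.toReal_nonneg]
  exact mul_le_mul_of_nonneg_left (hB z) ENNReal.toReal_nonneg

theorem expect_mono (μ : PMF α) {f g : α → ℝ} (hf : IsBdd f) (hg : IsBdd g)
    (h : ∀ z, μ z ≠ 0 → f z ≤ g z) : μ.expect f ≤ μ.expect g := by
  refine (μ.summable_mul hf).tsum_le_tsum (fun z => ?_) (μ.summable_mul hg)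
  by_cases hz : μ z = 0
  · simp [hz]
  · exact mul_le_mul_of_nonneg_left (h z hz) ENNReal.toReal_nonneg

theorem expect_const (μ : PMF α) (c : ℝ) : μ.expect (fun _ => c) = c := by
  rw [expect, tsum_mul_right, μ.tsum_toReal, one_mul]

theorem expect_add (μ : PMF α) {f g : α → ℝ} (hf : IsBdd f) (hg : IsBdd g) :
    μ.expect (fun z => f z + g z) = μ.expect f + μ.expect g := by
  simp only [expect, mul_add]
  exact (μ.summable_mul hf).tsum_add (μ.summable_mul hg)

theorem expect_const_mul (μ : PMF α) (c : ℝ) (f : α → ℝ) :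
    μ.expect (fun z => c * f z) = c * μ.expect f := by
  simp only [expect, ← tsum_mul_left]
  exact tsum_congr fun z => by ring

theorem abs_expect_le (μ : PMF α) {f : α → ℝ} {B : ℝ} (hB : ∀ z, |f z| ≤ B) :
    |μ.expect f| ≤ B := by
  have hf : IsBdd f := ⟨B, hB⟩
  rw [abs_le]
  constructor
  · rw [← μ.expect_const (-B)]
    exact μ.expect_mono (.const _) hf fun z _ => (abs_le.1 (hB z)).1
  · rw [← μ.expect_const B]
    exact μ.expect_mono hf (.const _) fun z _ => (abs_le.1 (hB z)).2

theorem expect_pure (a : α) (f : α → ℝ) : (PMF.pure a).expect f = f a := by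
  classical
  rw [expect, tsum_eq_single a]
  · simp
  · intro b hb
    simp [PMF.pure_apply, hb]

theorem expect_bind (μ : PMF α) (κ : α → PMF γ) {f : γ → ℝ} (hf : IsBdd f) :
    (μ.bind κ).expect f = μ.expect fun a => (κ a).expect f := by
  obtain ⟨B, hB⟩ := hf
  -- The joint weights have total mass one, which gives the absolute summability needed to exchange
  -- the two sums.
  have htot : ∑' q : α × γ, μ q.1 * κ q.1 q.2 = 1 := by
    rw [ENNReal.tsum_prod (f := fun a b => μ a * κ a b)]
    simp only [ENNReal.tsum_mul_left, tsum_coe, mul_one]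
  have hs : Summable fun q : α × γ => (μ q.1 * κ q.1 q.2).toReal :=
    ENNReal.summable_toReal (by rw [htot]; exact ENNReal.one_ne_top)
  have hs' : Summable (Function.uncurry fun (a : α) (b : γ) => (μ a * κ a b).toReal * f b) := by
    refine Summable.of_norm_bounded (hs.mul_right B) fun q => ?_
    simp only [Function.uncurry]
    rw [Real.norm_eq_abs, abs_mul, abs_of_nonneg ENNReal.toReal_nonneg]
    exact mul_le_mul_of_nonneg_left (hB q.2) ENNReal.toReal_nonneg
  have h1 : ∀ b, ((μ.bind κ) b).toReal * f b = ∑' a, (μ a * κ a b).toReal * f b := fun b => by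
    rw [bind_apply, ENNReal.tsum_toReal_eq, tsum_mul_right]
    exact fun a => ENNReal.mul_ne_top (μ.apply_ne_top a) ((κ a).apply_ne_top b)
  simp only [expect, h1]
  rw [hs'.tsum_comm]
  refine tsum_congr fun a => ?_
  rw [← tsum_mul_left]
  exact tsum_congr fun b => by rw [ENNReal.toReal_mul, mul_assoc]

theorem expect_map (μ : PMF α) (e : α → γ) {f : γ → ℝ} (hf : IsBdd f) :
    (μ.map e).expect f = μ.expect fun a => f (e a) := by
  rw [PMF.map, expect_bind _ _ hf]
  simp only [Function.comp_apply, expect_pure]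

end PMF

/-! ### Discounted expectations under an arbitrary policy -/

namespace POArm

variable {M L : ℕ} (X : POArm M L) {ω₀ : Belief M}

/-- The expected value of `h` at the next state. -/
def nextValue (a : Bool) (h : X.State ω₀ → ℝ) (s : X.State ω₀) : ℝ := (X.trans a s).expect h

open Classical in
/-- The states that can follow `s`. -/
def successors (s : X.State ω₀) : Finset (X.State ω₀) :=
  Finset.univ.image fun o : Option (Fin L) => X.stateUpdate o s

theorem mem_successors {a : Bool} {s j : X.State ω₀} (h : X.trans a s j ≠ 0) :
    j ∈ X.successors s := by
  classical
  rw [← PMF.mem_support_iff] at h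
  simp only [successors, Finset.mem_image, Finset.mem_univ, true_and]
  cases a with
  | true =>
    obtain ⟨l, -, hl⟩ := (PMF.mem_support_map_iff _ _ _).1 h
    exact ⟨some l, hl⟩
  | false => exact ⟨none, ((PMF.mem_support_pure_iff _ _).1 h).symm⟩

/-- A state has finitely many successors, so one-step expectations commute with series and limits
without further hypotheses. -/
theorem nextValue_eq_sum (a : Bool) (h : X.State ω₀ → ℝ) (s : X.State ω₀) :
    X.nextValue a h s = ∑ j ∈ X.successors s, X.p a s j * h j := by
  refine tsum_eq_sum fun j hj => ?_
  have : X.trans a s j = 0 := by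
    by_contra h0
    exact hj (X.mem_successors h0)
  simp [this]

theorem isBdd_nextValue {h : X.State ω₀ → ℝ} (hh : IsBdd h) :
    IsBdd fun z : X.State ω₀ × Bool => X.nextValue z.2 h z.1 := by
  obtain ⟨B, hB⟩ := hh
  exact ⟨B, fun z => PMF.abs_expect_le _ hB⟩

theorem nextValue_const (a : Bool) (c : ℝ) (s : X.State ω₀) : X.nextValue a (fun _ => c) s = c :=
  PMF.expect_const _ _

theorem tsum_p_sub_p_mul (h : X.State ω₀ → ℝ) (s : X.State ω₀) :
    ∑' j, (X.p true s j - X.p false s j) * h j =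
      X.nextValue true h s - X.nextValue false h s := by
  rw [X.nextValue_eq_sum, X.nextValue_eq_sum, ← Finset.sum_sub_distrib]
  simp only [← sub_mul]
  refine tsum_eq_sum fun j hj => ?_
  have : ∀ a, X.trans a s j = 0 := fun a => by
    by_contra h0
    exact hj (X.mem_successors h0)
  simp [p, this]

variable (β : ℝ) (π : X.Policy ω₀) (i : X.State ω₀)

theorem expect_stateActionLaw (t : ℕ) {f : X.State ω₀ × Bool → ℝ} (hf : IsBdd f) :
    (X.stateActionLaw π i t).expect f =
      (X.historyLaw π i t).expect fun z => (π z.1 z.2).expect fun a => f (z.2, a) := by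
  rw [stateActionLaw, PMF.expect_bind _ _ hf]
  simp only [PMF.expect_map _ _ hf]

theorem expect_stateActionLaw_fst (t : ℕ) {h : X.State ω₀ → ℝ} (hh : IsBdd h) :
    (X.stateActionLaw π i t).expect (fun z => h z.1) =
      (X.historyLaw π i t).expect fun z => h z.2 := by
  rw [X.expect_stateActionLaw π i t (hh.comp Prod.fst)]
  simp only [PMF.expect_const]

theorem expect_historyLaw_succ (t : ℕ) {h : X.State ω₀ → ℝ} (hh : IsBdd h) :
    (X.historyLaw π i (t + 1)).expect (fun z => h z.2) =
      (X.stateActionLaw π i t).expect fun z => X.nextValue z.2 h z.1 := by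
  rw [X.expect_stateActionLaw π i t (X.isBdd_nextValue hh), historyLaw,
    PMF.expect_bind _ _ (hh.comp Prod.snd)]
  congr 1
  funext z
  rw [PMF.expect_bind _ _ (hh.comp Prod.snd)]
  congr 1
  funext a
  rw [PMF.expect_map _ _ (hh.comp Prod.snd)]
  rfl

theorem exists_of_stateActionLaw_ne_zero {t : ℕ} {z : X.State ω₀ × Bool}
    (h : X.stateActionLaw π i t z ≠ 0) : ∃ past, π past z.1 z.2 ≠ 0 := by
  rw [← PMF.mem_support_iff, stateActionLaw, PMF.mem_support_bind_iff] at h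
  obtain ⟨y, -, hy⟩ := h
  obtain ⟨a, ha, rfl⟩ := (PMF.mem_support_map_iff _ _ _).1 hy
  exact ⟨y.1, (PMF.mem_support_iff _ _).1 ha⟩

variable {β}

theorem discounted_eq (f : X.State ω₀ × Bool → ℝ) :
    X.discounted β π i f = ∑' t : ℕ, β ^ t * (X.stateActionLaw π i t).expect f := rfl

theorem summable_discounted (hβ0 : 0 ≤ β) (hβ1 : β < 1) {f : X.State ω₀ × Bool → ℝ}
    (hf : IsBdd f) : Summable fun t : ℕ => β ^ t * (X.stateActionLaw π i t).expect f := by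
  obtain ⟨B, hB⟩ := hf
  refine Summable.of_norm_bounded ((summable_geometric_of_lt_one hβ0 hβ1).mul_right B) fun t => ?_
  rw [Real.norm_eq_abs, abs_mul, abs_of_nonneg (pow_nonneg hβ0 t)]
  exact mul_le_mul_of_nonneg_left (PMF.abs_expect_le _ hB) (pow_nonneg hβ0 t)

/-- Only actions that the policy can choose matter; this is how properties of a policy enter all
later comparisons. -/
theorem discounted_mono (hβ0 : 0 ≤ β) (hβ1 : β < 1) {f g : X.State ω₀ × Bool → ℝ}
    (hf : IsBdd f) (hg : IsBdd g) (h : ∀ past s a, π past s a ≠ 0 → f (s, a) ≤ g (s, a)) :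
    X.discounted β π i f ≤ X.discounted β π i g := by
  refine (X.summable_discounted π i hβ0 hβ1 hf).tsum_le_tsum (fun t => ?_)
    (X.summable_discounted π i hβ0 hβ1 hg)
  refine mul_le_mul_of_nonneg_left (PMF.expect_mono _ hf hg fun z hz => ?_) (pow_nonneg hβ0 t)
  obtain ⟨past, hp⟩ := X.exists_of_stateActionLaw_ne_zero π i hz
  exact h past z.1 z.2 hp

theorem discounted_congr (hβ0 : 0 ≤ β) (hβ1 : β < 1) {f g : X.State ω₀ × Bool → ℝ}
    (hf : IsBdd f) (hg : IsBdd g) (h : ∀ past s a, π past s a ≠ 0 → f (s, a) = g (s, a)) :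
    X.discounted β π i f = X.discounted β π i g :=
  le_antisymm (X.discounted_mono π i hβ0 hβ1 hf hg fun q s a hp => (h q s a hp).le)
    (X.discounted_mono π i hβ0 hβ1 hg hf fun q s a hp => (h q s a hp).ge)

theorem discounted_add (hβ0 : 0 ≤ β) (hβ1 : β < 1) {f g : X.State ω₀ × Bool → ℝ}
    (hf : IsBdd f) (hg : IsBdd g) : X.discounted β π i (fun z => f z + g z) =
      X.discounted β π i f + X.discounted β π i g := by
  simp only [discounted_eq, PMF.expect_add _ hf hg, mul_add]
  exact (X.summable_discounted π i hβ0 hβ1 hf).tsum_add (X.summable_discounted π i hβ0 hβ1 hg)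

theorem discounted_const_mul (c : ℝ) (f : X.State ω₀ × Bool → ℝ) :
    X.discounted β π i (fun z => c * f z) = c * X.discounted β π i f := by
  simp only [discounted_eq, PMF.expect_const_mul, ← tsum_mul_left]
  exact tsum_congr fun t => by ring

theorem discounted_sub (hβ0 : 0 ≤ β) (hβ1 : β < 1) {f g : X.State ω₀ × Bool → ℝ}
    (hf : IsBdd f) (hg : IsBdd g) : X.discounted β π i (fun z => f z - g z) =
      X.discounted β π i f - X.discounted β π i g := by
  have := X.discounted_add π i hβ0 hβ1 hf (hg.const_mul (-1))
  rw [X.discounted_const_mul] at this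
  simpa only [sub_eq_add_neg, neg_mul, one_mul] using this

theorem discounted_const (hβ0 : 0 ≤ β) (hβ1 : β < 1) (c : ℝ) :
    X.discounted β π i (fun _ => c) = c / (1 - β) := by
  simp only [discounted_eq, PMF.expect_const]
  rw [tsum_mul_right, tsum_geometric_of_lt_one hβ0 hβ1, div_eq_mul_inv, mul_comm]

theorem isBdd_discounted (hβ0 : 0 ≤ β) (hβ1 : β < 1) {f : X.State ω₀ × Bool → ℝ} (hf : IsBdd f) :
    IsBdd fun i => X.discounted β π i f := by
  obtain ⟨B, hB⟩ := id hf
  refine ⟨B / (1 - β), fun i => abs_le.2 ⟨?_, ?_⟩⟩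
  · rw [← neg_div, ← X.discounted_const π i hβ0 hβ1]
    exact X.discounted_mono π i hβ0 hβ1 (.const _) hf fun _ s a _ => (abs_le.1 (hB (s, a))).1
  · rw [← X.discounted_const π i hβ0 hβ1]
    exact X.discounted_mono π i hβ0 hβ1 hf (.const _) fun _ s a _ => (abs_le.1 (hB (s, a))).2

theorem expect_stateActionLaw_zero {f : X.State ω₀ × Bool → ℝ} (hf : IsBdd f) :
    (X.stateActionLaw π i 0).expect f = (π [] i).expect fun a => f (i, a) := by
  rw [X.expect_stateActionLaw π i 0 hf, historyLaw, PMF.expect_pure]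

/-- The reward of the first slot bounds the total of nonnegative rewards from below. -/
theorem le_discounted_of_nonneg (hβ0 : 0 ≤ β) (hβ1 : β < 1) {f : X.State ω₀ × Bool → ℝ}
    (hf : IsBdd f) (h : ∀ past s a, π past s a ≠ 0 → 0 ≤ f (s, a)) {a : Bool}
    (ha : π [] i = PMF.pure a) : f (i, a) ≤ X.discounted β π i f := by
  have h0 : f (i, a) = β ^ 0 * (X.stateActionLaw π i 0).expect f := by
    rw [X.expect_stateActionLaw_zero π i hf, ha, PMF.expect_pure, pow_zero, one_mul]
  rw [h0]
  refine (X.summable_discounted π i hβ0 hβ1 hf).le_tsum 0 fun t _ => ?_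
  refine mul_nonneg (pow_nonneg hβ0 t) ?_
  rw [← (X.stateActionLaw π i t).expect_const 0]
  refine PMF.expect_mono _ (.const _) hf fun z hz => ?_
  obtain ⟨past, hp⟩ := X.exists_of_stateActionLaw_ne_zero π i hz
  exact h past z.1 z.2 hp

/-- Discounted increments of a bounded function of the state telescope under every policy. -/
theorem discounted_sub_nextValue (hβ0 : 0 ≤ β) (hβ1 : β < 1) {h : X.State ω₀ → ℝ} (hh : IsBdd h) :
    X.discounted β π i (fun z => h z.1 - β * X.nextValue z.2 h z.1) = h i := by
  have hfst : IsBdd fun z : X.State ω₀ × Bool => h z.1 := hh.comp Prod.fst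
  rw [X.discounted_sub π i hβ0 hβ1 hfst ((X.isBdd_nextValue hh).const_mul β),
    X.discounted_const_mul, discounted_eq, discounted_eq,
    (X.summable_discounted π i hβ0 hβ1 hfst).tsum_eq_zero_add, ← tsum_mul_left]
  -- The expected next value at time `t` is the expected value at time `t + 1`, so the two series
  -- cancel except for the term at time zero.
  simp only [← X.expect_historyLaw_succ π i _ hh, X.expect_stateActionLaw_fst π i _ hh]
  simp only [pow_succ', mul_assoc, pow_zero, one_mul]
  rw [historyLaw, PMF.expect_pure, add_sub_cancel_right]

end POArm

/-! ### Stationary policies and the advantage of deviating from them -/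

namespace POArm

variable {M L : ℕ} (X : POArm M L) {ω₀ : Belief M} {β : ℝ}

open Classical in
/-- One step of the chain that is active exactly in the states of `D`. -/
def priorityStep (D : Set (X.State ω₀)) (h : X.State ω₀ → ℝ) (s : X.State ω₀) : ℝ :=
  X.nextValue (decide (s ∈ D)) h s

theorem isBdd_priorityStep (D : Set (X.State ω₀)) {h : X.State ω₀ → ℝ} (hh : IsBdd h) :
    IsBdd (X.priorityStep D h) := by
  classical
  exact (X.isBdd_nextValue hh).comp fun s : X.State ω₀ => (s, decide (s ∈ D))

theorem abs_iterate_priorityStep_le (D : Set (X.State ω₀)) {h : X.State ω₀ → ℝ} {B : ℝ}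
    (hB : ∀ s, |h s| ≤ B) (t : ℕ) (s : X.State ω₀) : |(X.priorityStep D)^[t] h s| ≤ B := by
  induction t generalizing s with
  | zero => exact hB s
  | succ t ih =>
    rw [Function.iterate_succ_apply']
    exact PMF.abs_expect_le _ ih

theorem expect_historyLaw_priorityPolicy (D : Set (X.State ω₀)) (i : X.State ω₀) (t : ℕ)
    {h : X.State ω₀ → ℝ} (hh : IsBdd h) :
    (X.historyLaw (X.priorityPolicy D) i t).expect (fun z => h z.2) =
      (X.priorityStep D)^[t] h i := by
  -- The last step of the history is absorbed into `h`, which must therefore vary in the induction.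
  induction t generalizing h with
  | zero => rw [historyLaw, PMF.expect_pure]; rfl
  | succ t ih =>
    rw [X.expect_historyLaw_succ _ _ _ hh, X.expect_stateActionLaw _ _ _ (X.isBdd_nextValue hh),
      Function.iterate_succ_apply, ← ih (X.isBdd_priorityStep D hh)]
    simp only [priorityPolicy, PMF.expect_pure, priorityStep]

open Classical in
theorem discounted_priorityPolicy (D : Set (X.State ω₀)) (i : X.State ω₀)
    {c : X.State ω₀ × Bool → ℝ} (hc : IsBdd c) :
    X.discounted β (X.priorityPolicy D) i c =
      ∑' t : ℕ, β ^ t * (X.priorityStep D)^[t] (fun s => c (s, decide (s ∈ D))) i := by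
  rw [discounted_eq]
  refine tsum_congr fun t => ?_
  rw [X.expect_stateActionLaw _ _ _ hc, ← X.expect_historyLaw_priorityPolicy D i t
    (hc.comp fun s => (s, decide (s ∈ D)))]
  simp only [priorityPolicy, PMF.expect_pure]

open Classical in
/-- The evaluation equation of a stationary policy. -/
theorem discounted_priorityPolicy_eq (hβ0 : 0 ≤ β) (hβ1 : β < 1) (D : Set (X.State ω₀))
    (s : X.State ω₀) {c : X.State ω₀ × Bool → ℝ} (hc : IsBdd c) :
    X.discounted β (X.priorityPolicy D) s c = c (s, decide (s ∈ D)) +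
      β * X.nextValue (decide (s ∈ D)) (fun j => X.discounted β (X.priorityPolicy D) j c) s := by
  obtain ⟨B, hB⟩ := id hc
  have hsum : ∀ j, Summable fun t : ℕ =>
      β ^ t * (X.priorityStep D)^[t] (fun s => c (s, decide (s ∈ D))) j := fun j => by
    refine Summable.of_norm_bounded ((summable_geometric_of_lt_one hβ0 hβ1).mul_right B)
      fun t => ?_
    rw [Real.norm_eq_abs, abs_mul, abs_of_nonneg (pow_nonneg hβ0 t)]
    exact mul_le_mul_of_nonneg_left (X.abs_iterate_priorityStep_le D (fun s => hB _) t j)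
      (pow_nonneg hβ0 t)
  simp only [X.discounted_priorityPolicy D _ hc]
  rw [(hsum s).tsum_eq_zero_add, pow_zero, one_mul, Function.iterate_zero, id,
    X.nextValue_eq_sum]
  simp only [← tsum_mul_left]
  rw [← Summable.tsum_finsetSum fun j _ => (hsum j).mul_left _, ← tsum_mul_left]
  congr 1
  refine tsum_congr fun t => ?_
  rw [Function.iterate_succ_apply', priorityStep, X.nextValue_eq_sum, Finset.mul_sum,
    Finset.mul_sum]
  exact Finset.sum_congr rfl fun j _ => by ring

/-- The advantage of the active over the passive action in the state `s`, for the reward `c`, when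
the arm is afterwards active exactly in the states of `D`. -/
def gap (β : ℝ) (D : Set (X.State ω₀)) (c : X.State ω₀ × Bool → ℝ) (s : X.State ω₀) : ℝ :=
  c (s, true) - c (s, false) +
    β * (X.nextValue true (fun j => X.discounted β (X.priorityPolicy D) j c) s -
      X.nextValue false (fun j => X.discounted β (X.priorityPolicy D) j c) s)

theorem isBdd_gap (hβ0 : 0 ≤ β) (hβ1 : β < 1) (D : Set (X.State ω₀))
    {c : X.State ω₀ × Bool → ℝ} (hc : IsBdd c) : IsBdd (X.gap β D c) := by
  have h := X.isBdd_nextValue (X.isBdd_discounted (X.priorityPolicy D) hβ0 hβ1 hc)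
  exact ((hc.comp fun s => (s, true)).sub (hc.comp fun s => (s, false))).add
    (((h.comp fun s : X.State ω₀ => (s, true)).sub (h.comp fun s => (s, false))).const_mul β)

open Classical in
/-- The signed advantage collected by the actions that deviate from the set `D`. -/
def deviation (β : ℝ) (D : Set (X.State ω₀)) (c : X.State ω₀ × Bool → ℝ)
    (z : X.State ω₀ × Bool) : ℝ :=
  if z.2 = true then (if z.1 ∈ D then 0 else X.gap β D c z.1)
  else (if z.1 ∈ D then -X.gap β D c z.1 else 0)

theorem isBdd_deviation (hβ0 : 0 ≤ β) (hβ1 : β < 1) (D : Set (X.State ω₀))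
    {c : X.State ω₀ × Bool → ℝ} (hc : IsBdd c) : IsBdd (X.deviation β D c) := by
  classical
  have h := (X.isBdd_gap hβ0 hβ1 D hc).comp (Prod.fst : X.State ω₀ × Bool → _)
  exact (((IsBdd.const 0).ite h _).ite (h.neg.ite (.const 0) _) _)

/-- The reward of any policy is that of a stationary policy plus the advantage of the deviations
from it. -/
theorem discounted_eq_add_deviation (hβ0 : 0 ≤ β) (hβ1 : β < 1) (D : Set (X.State ω₀))
    (π : X.Policy ω₀) (i : X.State ω₀) {c : X.State ω₀ × Bool → ℝ} (hc : IsBdd c) :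
    X.discounted β π i c = X.discounted β (X.priorityPolicy D) i c +
      X.discounted β π i (X.deviation β D c) := by
  classical
  have hV := X.isBdd_discounted (X.priorityPolicy D) hβ0 hβ1 hc
  -- By the evaluation equation, `c` is the telescoping increment of the value function if the
  -- action agrees with `D`. If it does not, the two differ by the advantage, with the sign of the
  -- switch.
  have key : c = fun z => (X.discounted β (X.priorityPolicy D) z.1 c -
      β * X.nextValue z.2 (fun j => X.discounted β (X.priorityPolicy D) j c) z.1) +
      X.deviation β D c z := by
    funext ⟨s, a⟩
    rw [X.discounted_priorityPolicy_eq hβ0 hβ1 D s hc]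
    by_cases hs : s ∈ D <;> cases a <;> simp [deviation, gap, hs] <;> ring
  conv_lhs => rw [key]
  rw [X.discounted_add π i hβ0 hβ1
    ((hV.comp Prod.fst).sub ((X.isBdd_nextValue hV).const_mul β))
    (X.isBdd_deviation hβ0 hβ1 D hc),
    X.discounted_sub_nextValue π i hβ0 hβ1 hV]

/-- Changing the active set in states without advantage changes no value. -/
theorem discounted_priorityPolicy_congr (hβ0 : 0 ≤ β) (hβ1 : β < 1) {D D' : Set (X.State ω₀)}
    {c : X.State ω₀ × Bool → ℝ} (hc : IsBdd c)
    (h : ∀ s, ¬(s ∈ D ↔ s ∈ D') → X.gap β D c s = 0) (i : X.State ω₀) :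
    X.discounted β (X.priorityPolicy D') i c = X.discounted β (X.priorityPolicy D) i c := by
  classical
  rw [X.discounted_eq_add_deviation hβ0 hβ1 D (X.priorityPolicy D') i hc, add_eq_left,
    X.discounted_congr _ i hβ0 hβ1 (X.isBdd_deviation hβ0 hβ1 D hc) (.const 0),
    X.discounted_const _ i hβ0 hβ1, zero_div]
  intro past s a ha
  have ha' : a = decide (s ∈ D') := by
    by_contra hne
    exact ha (by simp [priorityPolicy, PMF.pure_apply, hne])
  subst ha'
  -- Relative to `D`, the policy for `D'` deviates only where the two sets differ, and there the
  -- advantage is zero.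
  by_cases hD : s ∈ D <;> by_cases hD' : s ∈ D' <;> simp [deviation, hD, hD']
  all_goals exact h s (by simp [hD, hD'])

theorem gap_congr (hβ0 : 0 ≤ β) (hβ1 : β < 1) {D D' : Set (X.State ω₀)}
    {c : X.State ω₀ × Bool → ℝ} (hc : IsBdd c)
    (h : ∀ s, ¬(s ∈ D ↔ s ∈ D') → X.gap β D c s = 0) : X.gap β D' c = X.gap β D c := by
  funext s
  simp only [gap, X.discounted_priorityPolicy_congr hβ0 hβ1 hc h]

/-- Values are linear in the reward, and the constant `lam` adds `lam / (1 - β)` to all of them,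
which cancels in the difference of the two actions. For a fixed active set the advantage is thus
affine in the subsidy. -/
theorem gap_sub_const_mul (hβ0 : 0 ≤ β) (hβ1 : β < 1) (D : Set (X.State ω₀)) (lam : ℝ)
    {c d : X.State ω₀ × Bool → ℝ} (hc : IsBdd c) (hd : IsBdd d) (s : X.State ω₀) :
    X.gap β D (fun z => c z - lam * d z + lam) s = X.gap β D c s - lam * X.gap β D d s := by
  have hV : ∀ j, X.discounted β (X.priorityPolicy D) j (fun z => c z - lam * d z + lam) =
      X.discounted β (X.priorityPolicy D) j c - lam * X.discounted β (X.priorityPolicy D) j d +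
        lam / (1 - β) := fun j => by
    rw [X.discounted_add _ _ hβ0 hβ1 (hc.sub (hd.const_mul lam)) (.const lam),
      X.discounted_sub _ _ hβ0 hβ1 hc (hd.const_mul lam), X.discounted_const_mul,
      X.discounted_const _ _ hβ0 hβ1]
  have hc' := X.isBdd_discounted (X.priorityPolicy D) hβ0 hβ1 hc
  have hd' := X.isBdd_discounted (X.priorityPolicy D) hβ0 hβ1 hd
  have hN : ∀ a, X.nextValue a (fun j =>
      X.discounted β (X.priorityPolicy D) j (fun z => c z - lam * d z + lam)) s =
      X.nextValue a (fun j => X.discounted β (X.priorityPolicy D) j c) s -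
        lam * X.nextValue a (fun j => X.discounted β (X.priorityPolicy D) j d) s +
        lam / (1 - β) := fun a => by
    simp only [hV, X.nextValue_eq_sum, mul_add, mul_sub, Finset.sum_add_distrib,
      Finset.sum_sub_distrib, Finset.mul_sum]
    rw [← X.nextValue_eq_sum a (fun _ => lam / (1 - β)), X.nextValue_const]
    congr 2
    exact Finset.sum_congr rfl fun j _ => by ring
  simp only [gap, hN]
  ring

/-! ### Continuity in the active set -/

open Filter Topology in
/-- Values of stationary policies depend continuously on the active set. -/
theorem tendsto_discounted_priorityPolicy (hβ0 : 0 ≤ β) (hβ1 : β < 1) {κ : Type*} {F : Filter κ}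
    {D : κ → Set (X.State ω₀)} {D' : Set (X.State ω₀)}
    (hD : ∀ s, ∀ᶠ n in F, (s ∈ D n ↔ s ∈ D')) {c : X.State ω₀ × Bool → ℝ} (hc : IsBdd c)
    (i : X.State ω₀) :
    Tendsto (fun n => X.discounted β (X.priorityPolicy (D n)) i c) F
      (𝓝 (X.discounted β (X.priorityPolicy D') i c)) := by
  classical
  obtain ⟨B, hB⟩ := id hc
  simp only [X.discounted_priorityPolicy _ _ hc]
  -- The first `t` steps visit finitely many states, on which the active sets eventually agree. Each
  -- term of the series is thus eventually constant, and geometric domination does the rest.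
  have hev : ∀ (t : ℕ) (s : X.State ω₀), ∀ᶠ n in F,
      (X.priorityStep (D n))^[t] (fun s => c (s, decide (s ∈ D n))) s =
        (X.priorityStep D')^[t] (fun s => c (s, decide (s ∈ D'))) s := by
    intro t
    induction t with
    | zero =>
      intro s
      filter_upwards [hD s] with n hn
      simp only [Function.iterate_zero, id, hn]
    | succ t ih =>
      intro s
      have hall := (eventually_all_finset (X.successors s)).2 fun j _ => ih j
      filter_upwards [hD s, hall] with n hn hsucc
      rw [Function.iterate_succ_apply', Function.iterate_succ_apply', priorityStep, priorityStep,
        X.nextValue_eq_sum, X.nextValue_eq_sum]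
      simp only [hn]
      exact Finset.sum_congr rfl fun j hj => by rw [hsucc j hj]
  refine tendsto_tsum_of_dominated_convergence (bound := fun t : ℕ => β ^ t * B)
    ((summable_geometric_of_lt_one hβ0 hβ1).mul_right B) (fun t => ?_) (Eventually.of_forall ?_)
  · refine tendsto_const_nhds.congr' ?_
    filter_upwards [hev t i] with n hn
    rw [hn]
  · intro n t
    rw [Real.norm_eq_abs, abs_mul, abs_of_nonneg (pow_nonneg hβ0 t)]
    exact mul_le_mul_of_nonneg_left (X.abs_iterate_priorityStep_le (D n) (fun s => hB _) t i)
      (pow_nonneg hβ0 t)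

open Filter Topology in
theorem tendsto_gap (hβ0 : 0 ≤ β) (hβ1 : β < 1) {κ : Type*} {F : Filter κ}
    {D : κ → Set (X.State ω₀)} {D' : Set (X.State ω₀)}
    (hD : ∀ s, ∀ᶠ n in F, (s ∈ D n ↔ s ∈ D')) {c : X.State ω₀ × Bool → ℝ} (hc : IsBdd c)
    (s : X.State ω₀) : Tendsto (fun n => X.gap β (D n) c s) F (𝓝 (X.gap β D' c s)) := by
  have hN : ∀ a, Tendsto (fun n => X.nextValue a
      (fun j => X.discounted β (X.priorityPolicy (D n)) j c) s) F
      (𝓝 (X.nextValue a (fun j => X.discounted β (X.priorityPolicy D') j c) s)) := fun a => by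
    simp only [X.nextValue_eq_sum]
    exact tendsto_finsetSum _ fun j _ =>
      (X.tendsto_discounted_priorityPolicy hβ0 hβ1 hD hc j).const_mul _
  exact tendsto_const_nhds.add (((hN true).sub (hN false)).const_mul β)

/-! ### The coefficients as advantages, and the weighted sums as discounted totals -/

/-- The indicator of the active action. -/
def activity (z : X.State ω₀ × Bool) : ℝ := if z.2 = true then 1 else 0

/-- The reward paid by the original arm. -/
def activeReward (z : X.State ω₀ × Bool) : ℝ := if z.2 = true then X.reward z.1 else 0

theorem isBdd_activity : IsBdd (X.activity (ω₀ := ω₀)) :=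
  (IsBdd.const 1).ite (.const 0) _

theorem isBdd_activeReward : IsBdd (X.activeReward (ω₀ := ω₀)) := by
  have hr : IsBdd fun ω : Belief M => X.reward ω := by
    refine ⟨∑ i, |∑ j, X.E i j * X.r i j|, fun ω => ?_⟩
    refine (Finset.abs_sum_le_sum_abs _ _).trans (Finset.sum_le_sum fun i _ => ?_)
    rw [abs_mul, abs_of_nonneg (ω.2.1 i)]
    refine mul_le_of_le_one_left (abs_nonneg _) ?_
    rw [← ω.2.2]
    exact Finset.single_le_sum (fun j _ => ω.2.1 j) (Finset.mem_univ i)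
  exact (hr.comp fun z : X.State ω₀ × Bool => z.1.1).ite (.const 0) _

theorem coeffA_eq_gap (Ω : Set (X.State ω₀)) (s : X.State ω₀) :
    X.coeffA β Ω s = X.gap β Ωᶜ X.activity s := by
  rw [coeffA, X.tsum_p_sub_p_mul]
  refine congrArg₂ (· + ·) ?_ rfl
  simp [activity]

theorem coeffW_eq_gap (Ω : Set (X.State ω₀)) (s : X.State ω₀) :
    X.coeffW β Ω s = X.gap β Ωᶜ X.activeReward s := by
  rw [coeffW, X.tsum_p_sub_p_mul]
  refine congrArg₂ (· + ·) ?_ rfl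
  simp [activeReward]

open Classical in
theorem x_eq_tsum (a : Bool) (ω : X.State ω₀) (π : X.Policy ω₀) (i : X.State ω₀) :
    X.x β a ω π i = ∑' t : ℕ, β ^ t * (X.stateActionLaw π i t (ω, a)).toReal := by
  refine tsum_congr fun t => ?_
  rw [tsum_eq_single (ω, a)]
  · simp
  · intro z hz
    simp [hz]

/-- Discounted sums of substochastic rows may be taken in either order. -/
theorem _root_.tsum_mul_tsum_pow_mul_comm {α : Type*} (hβ0 : 0 ≤ β) (hβ1 : β < 1)
    {m : ℕ → α → ℝ} (h0 : ∀ t s, 0 ≤ m t s) (hm : ∀ t, Summable (m t))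
    (hm1 : ∀ t, ∑' s, m t s ≤ 1) {u : α → ℝ} (hu : IsBdd u) :
    ∑' s, u s * ∑' t : ℕ, β ^ t * m t s = ∑' t : ℕ, β ^ t * ∑' s, m t s * u s := by
  obtain ⟨B, hB⟩ := hu
  have hq : ∀ q : ℕ × α, 0 ≤ β ^ q.1 * m q.1 q.2 := fun q =>
    mul_nonneg (pow_nonneg hβ0 _) (h0 _ _)
  have hdom : Summable fun q : ℕ × α => β ^ q.1 * m q.1 q.2 := by
    rw [summable_prod_of_nonneg hq]
    refine ⟨fun t => (hm t).mul_left (β ^ t), ?_⟩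
    refine Summable.of_nonneg_of_le (fun t => tsum_nonneg fun s => hq (t, s)) (fun t => ?_)
      (summable_geometric_of_lt_one hβ0 hβ1)
    exact (tsum_mul_left (a := β ^ t) (f := m t)).trans_le
      (mul_le_of_le_one_right (pow_nonneg hβ0 t) (hm1 t))
  have hs : Summable (Function.uncurry fun (t : ℕ) (s : α) => β ^ t * (m t s * u s)) := by
    refine Summable.of_norm_bounded (hdom.mul_right B) fun q => ?_
    simp only [Function.uncurry]
    rw [Real.norm_eq_abs, ← mul_assoc, abs_mul, abs_of_nonneg (hq q)]
    exact mul_le_mul_of_nonneg_left (hB q.2) (hq q)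
  simp only [← tsum_mul_left]
  rw [← hs.tsum_comm]
  exact tsum_congr fun s => tsum_congr fun t => by ring

theorem _root_.PMF.expect_ite_snd {α : Type*} (μ : PMF (α × Bool)) (u : α → ℝ) :
    μ.expect (fun z => if z.2 = true then u z.1 else 0) = ∑' s, (μ (s, true)).toReal * u s := by
  have hinj : Function.Injective fun s : α => (s, true) := fun s s' h => congrArg Prod.fst h
  rw [PMF.expect, ← hinj.tsum_eq]
  · simp
  · rintro ⟨s, a⟩ h
    cases a
    · simp at h
    · exact ⟨s, rfl⟩

theorem _root_.PMF.summable_toReal_fst {α : Type*} (μ : PMF (α × Bool)) (a : Bool) :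
    Summable fun s => (μ (s, a)).toReal :=
  μ.summable_toReal.comp_injective fun _ _ h => congrArg Prod.fst h

theorem _root_.PMF.tsum_toReal_fst_le_one {α : Type*} (μ : PMF (α × Bool)) (a : Bool) :
    ∑' s, (μ (s, a)).toReal ≤ 1 := by
  rw [← μ.tsum_toReal]
  exact (μ.summable_toReal_fst a).tsum_le_tsum_of_inj (fun s => (s, a))
    (fun _ _ h => congrArg Prod.fst h) (fun _ _ => ENNReal.toReal_nonneg) (fun _ => le_rfl)
    μ.summable_toReal

-- As a single discounted total, the weighted sum can be compared slot by slot and combined with the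
-- deviation formula.
open Classical in
theorem weightedSum_eq_discounted (hβ0 : 0 ≤ β) (hβ1 : β < 1) (Ω : Set (X.State ω₀))
    (π : X.Policy ω₀) (i : X.State ω₀) : X.weightedSum β Ω π i =
      X.discounted β π i fun z =>
        if z.2 = true then (if z.1 ∈ Ω then X.coeffA β Ω z.1 else 0) else 0 := by
  have hA : IsBdd (X.coeffA β Ω) := by
    rw [funext fun s => X.coeffA_eq_gap (β := β) Ω s]
    exact X.isBdd_gap hβ0 hβ1 Ωᶜ X.isBdd_activity
  rw [discounted_eq]
  simp only [PMF.expect_ite_snd _ fun s => if s ∈ Ω then X.coeffA β Ω s else 0]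
  rw [← tsum_mul_tsum_pow_mul_comm hβ0 hβ1 (fun _ _ => ENNReal.toReal_nonneg)
    (fun t => (X.stateActionLaw π i t).summable_toReal_fst true)
    (fun t => (X.stateActionLaw π i t).tsum_toReal_fst_le_one true) (hA.ite (.const 0) (· ∈ Ω)),
    weightedSum, tsum_subtype Ω fun s => X.coeffA β Ω s * X.x β true s π i]
  refine tsum_congr fun s => ?_
  rw [← x_eq_tsum]
  by_cases h : s ∈ Ω <;> simp [h]

end POArm

/-! ### A monotonicity criterion with countably many exceptions -/

open Filter Topology in
/-- A continuous function that does not increase immediately to the right of any point outside a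
countable set is antitone. -/
theorem antitone_of_eventually_le_right {g : ℝ → ℝ} (hg : Continuous g) {Z : Set ℝ}
    (hZ : Z.Countable) (h : ∀ x ∉ Z, ∀ᶠ y in 𝓝[>] x, g y ≤ g x) : Antitone g := by
  intro a b hab
  by_contra! hlt
  -- The level `c` is chosen off the countable set `g '' Z`, so that no exceptional point lies on
  -- it.
  obtain ⟨c, hc, hac, hcb⟩ := ((hZ.image g).dense_compl ℝ).exists_between hlt
  have hcomp : IsCompact (Set.Icc a b ∩ {t | g t ≤ c}) :=
    isCompact_Icc.inter_right (isClosed_le hg continuous_const)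
  -- Let `x` be the last point of the interval with `g ≤ c`. The inequality persists just to the
  -- right of `x`, by continuity if `g x < c` and by hypothesis if `g x = c`, which contradicts the
  -- choice of `x`.
  obtain ⟨x, ⟨⟨hax, hxb⟩, hxc⟩, hmax⟩ := hcomp.exists_isGreatest ⟨a, ⟨le_rfl, hab⟩, hac.le⟩
  have hxb' : x < b := lt_of_le_of_ne hxb (by rintro rfl; exact absurd hxc (not_le.2 hcb))
  have hev : ∀ᶠ y in 𝓝[>] x, g y ≤ c := by
    rcases lt_or_eq_of_le (show g x ≤ c from hxc) with hlt' | heq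
    · exact ((hg.tendsto x).eventually_lt_const hlt').filter_mono nhdsWithin_le_nhds |>.mono
        fun y hy => hy.le
    · rw [← heq]
      exact h x fun hx => hc ⟨x, hx, heq⟩
  obtain ⟨y, hyc, hxy, hyb⟩ := (hev.and (Ioo_mem_nhdsGT hxb')).exists
  exact absurd (hmax ⟨⟨hax.trans hxy.le, hyb.le⟩, hyc⟩) (not_le.2 hxy)

/-! ### What the conservation law and the chain provide -/

namespace POArm

variable {M L : ℕ} (X : POArm M L) {ω₀ : Belief M} {β : ℝ}

theorem priorityPolicy_ne_zero {D : Set (X.State ω₀)} {past : List (X.State ω₀ × Bool)}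
    {s : X.State ω₀} {a : Bool} (h : X.priorityPolicy D past s a ≠ 0) : a = true ↔ s ∈ D := by
  classical
  have : a = decide (s ∈ D) := by
    by_contra hne
    exact h (by simp [priorityPolicy, PMF.pure_apply, hne])
  simp [this]

open Classical in
theorem one_le_x_priorityPolicy (hβ0 : 0 ≤ β) (hβ1 : β < 1) (D : Set (X.State ω₀))
    (s : X.State ω₀) : 1 ≤ X.x β (decide (s ∈ D)) s (X.priorityPolicy D) s := by
  have := X.le_discounted_of_nonneg (X.priorityPolicy D) s hβ0 hβ1
    (f := fun z => if z = (s, decide (s ∈ D)) then 1 else 0)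
    ((IsBdd.const 1).ite (.const 0) _)
    (fun _ t a _ => by split_ifs <;> norm_num) (a := decide (s ∈ D)) rfl
  simpa [x] using this

-- Passive time is total time minus active time, and active time is expanded around the policy
-- active on `Ωᶜ`. The contributions of acting in `Ω` cancel, so the policy enters only through its
-- passive slots outside `Ω`.
open Classical in
theorem xAux_add_weightedSum (hβ0 : 0 ≤ β) (hβ1 : β < 1) (Ω : Set (X.State ω₀))
    (π : X.Policy ω₀) (i : X.State ω₀) :
    X.xAux β π i + X.weightedSum β Ω π i =
      1 / (1 - β) - X.discounted β (X.priorityPolicy Ωᶜ) i X.activity +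
      X.discounted β π i fun z =>
        if z.2 = true then 0 else (if z.1 ∈ Ω then 0 else X.coeffA β Ω z.1) := by
  have hact := X.isBdd_activity (ω₀ := ω₀)
  have hdev := X.isBdd_deviation hβ0 hβ1 Ωᶜ hact
  have hA : IsBdd fun z : X.State ω₀ × Bool => X.coeffA β Ω z.1 := by
    simp only [X.coeffA_eq_gap]
    exact (X.isBdd_gap hβ0 hβ1 Ωᶜ hact).comp Prod.fst
  have hrest : IsBdd fun z : X.State ω₀ × Bool =>
      if z.2 = true then 0 else (if z.1 ∈ Ω then 0 else X.coeffA β Ω z.1) :=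
    (IsBdd.const 0).ite ((IsBdd.const 0).ite hA _) _
  have hdec := X.discounted_eq_add_deviation hβ0 hβ1 Ωᶜ π i hact
  rw [X.weightedSum_eq_discounted hβ0 hβ1, xAux, ← X.discounted_add π i hβ0 hβ1
    ((IsBdd.const 1).ite (.const 0) _) ((hA.ite (.const 0) _).ite (.const 0) _)]
  have hpt : (fun z : X.State ω₀ × Bool => (if z.2 = false then (1 : ℝ) else 0) +
      if z.2 = true then (if z.1 ∈ Ω then X.coeffA β Ω z.1 else 0) else 0) =
      fun z => (1 - X.activity z) + X.deviation β Ωᶜ X.activity z +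
        if z.2 = true then 0 else (if z.1 ∈ Ω then 0 else X.coeffA β Ω z.1) := by
    funext ⟨s, a⟩
    by_cases hs : s ∈ Ω <;> cases a <;> simp [activity, deviation, hs, ← X.coeffA_eq_gap]
  rw [hpt, X.discounted_add π i hβ0 hβ1 (((IsBdd.const 1).sub hact).add hdev) hrest,
    X.discounted_add π i hβ0 hβ1 ((IsBdd.const 1).sub hact) hdev,
    X.discounted_sub π i hβ0 hβ1 (.const 1) hact, X.discounted_const π i hβ0 hβ1]
  linarith

/-- The partial conservation law forces the coefficients to be nonnegative. -/
theorem PartialConservationLaw.coeffA_nonneg {X : POArm M L} {F : Set (Set (X.State ω₀))}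
    (hF : X.PartialConservationLaw β F) (hβ0 : 0 ≤ β) (hβ1 : β < 1) {Ω : Set (X.State ω₀)}
    (hΩ : Ω ∈ F) (s : X.State ω₀) : 0 ≤ X.coeffA β Ω s := by
  classical
  have hact := X.isBdd_activity (ω₀ := ω₀)
  have hA : IsBdd fun z : X.State ω₀ × Bool => X.coeffA β Ω z.1 := by
    simp only [X.coeffA_eq_gap]
    exact (X.isBdd_gap hβ0 hβ1 Ωᶜ hact).comp Prod.fst
  -- Inside `Ω`, the bound is zero, attained by resting on `Ω`. Being active only in `s` gives `A_s`
  -- times an occupation time of at least one, and this product cannot be below the bound.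
  by_cases hs : s ∈ Ω
  · have hbdd : IsBdd fun z : X.State ω₀ × Bool =>
        if z.2 = true then (if z.1 ∈ Ω then X.coeffA β Ω z.1 else 0) else 0 :=
      (hA.ite (.const 0) _).ite (.const 0) _
    have h0 : X.weightedSum β Ω (X.priorityPolicy Ωᶜ) s = 0 := by
      rw [X.weightedSum_eq_discounted hβ0 hβ1,
        X.discounted_congr _ s hβ0 hβ1 hbdd (.const 0), X.discounted_const _ s hβ0 hβ1, zero_div]
      intro past j a ha
      have := X.priorityPolicy_ne_zero ha
      by_cases hj : j ∈ Ω <;> cases a <;> simp_all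
    have heq := hF.eq Ω hΩ (X.priorityPolicy Ωᶜ) s fun past j hj => by simp [priorityPolicy, hj]
    have hle := hF.le Ω hΩ (X.priorityPolicy {s}) s
    have h1 : X.weightedSum β Ω (X.priorityPolicy {s}) s =
        X.coeffA β Ω s * X.x β true s (X.priorityPolicy {s}) s := by
      rw [X.weightedSum_eq_discounted hβ0 hβ1, x, ← X.discounted_const_mul]
      refine X.discounted_congr _ s hβ0 hβ1 hbdd
        (((IsBdd.const 1).ite (.const 0) _).const_mul _) fun past j a ha => ?_
      have := X.priorityPolicy_ne_zero ha
      cases a <;> simp_all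
    have hx := X.one_le_x_priorityPolicy hβ0 hβ1 {s} s
    simp only [Set.mem_singleton_iff, decide_true] at hx
    rw [← heq, h0, h1] at hle
    exact nonneg_of_mul_nonneg_left hle (by linarith)
  -- Outside `Ω`, permanent activity attains the bound, while being passive only in `s` adds `A_s`
  -- times an occupation time of at least one.
  · have hbdd : IsBdd fun z : X.State ω₀ × Bool =>
        if z.2 = true then 0 else (if z.1 ∈ Ω then 0 else X.coeffA β Ω z.1) :=
      (IsBdd.const 0).ite ((IsBdd.const 0).ite hA _) _
    have heq := hF.eq_aux Ω hΩ (X.priorityPolicy Set.univ) s fun past j hj => by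
      simp [priorityPolicy]
    have hle := hF.le_aux Ω hΩ (X.priorityPolicy {s}ᶜ) s
    rw [← heq, X.xAux_add_weightedSum hβ0 hβ1, X.xAux_add_weightedSum hβ0 hβ1,
      add_le_add_iff_left] at hle
    have h0 : X.discounted β (X.priorityPolicy Set.univ) s (fun z =>
        if z.2 = true then 0 else (if z.1 ∈ Ω then 0 else X.coeffA β Ω z.1)) = 0 := by
      rw [X.discounted_congr _ s hβ0 hβ1 hbdd (.const 0), X.discounted_const _ s hβ0 hβ1, zero_div]
      intro past j a ha
      have := X.priorityPolicy_ne_zero ha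
      simp_all
    have h1 : X.discounted β (X.priorityPolicy {s}ᶜ) s (fun z =>
        if z.2 = true then 0 else (if z.1 ∈ Ω then 0 else X.coeffA β Ω z.1)) =
        X.coeffA β Ω s * X.x β false s (X.priorityPolicy {s}ᶜ) s := by
      rw [x, ← X.discounted_const_mul]
      refine X.discounted_congr _ s hβ0 hβ1 hbdd
        (((IsBdd.const 1).ite (.const 0) _).const_mul _) fun past j a ha => ?_
      have := X.priorityPolicy_ne_zero ha
      cases a <;> simp_all
    have hx := X.one_le_x_priorityPolicy hβ0 hβ1 {s}ᶜ s
    simp only [Set.mem_compl_iff, Set.mem_singleton_iff, not_true_eq_false, decide_false] at hx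
    rw [h0, h1] at hle
    exact nonneg_of_mul_nonneg_left hle (by linarith)

/-- `idx` is an injective index for which being active in `i` has no advantage exactly at the
subsidy `idx i`, the arm being active afterwards in the states of larger index, and for which the
marginal active times are nonnegative. -/
structure IsMarginalIndex (β : ℝ) (idx : X.State ω₀ → ℝ) : Prop where
  injective : Function.Injective idx
  nonneg : ∀ i s, 0 ≤ X.gap β {j | idx i < idx j} X.activity s
  ne_zero : ∀ i, X.gap β {j | idx i < idx j} X.activity i ≠ 0
  reward_eq : ∀ i, X.gap β {j | idx i < idx j} X.activeReward i =
    idx i * X.gap β {j | idx i < idx j} X.activity i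

/-- The chain consists of the sublevel sets of its own index, so from here on the index alone
carries the information. -/
theorem IsIndexChain.mem_iff {X : POArm M L} {F : Set (Set (X.State ω₀))}
    {C : X.State ω₀ → Set (X.State ω₀)} (hC : X.IsIndexChain β F C) (i j : X.State ω₀) :
    j ∈ C i ↔ X.chainIndex β C j ≤ X.chainIndex β C i := by
  by_cases hij : i = j
  · subst hij
    simp [hC.chain.self_mem i]
  · rcases hC.chain.total i j hij with h | h
    · exact iff_of_false (hC.chain.not_mem i j hij h) (not_le.2 (hC.strict i j hij h))
    · exact iff_of_true (h.1 (hC.chain.self_mem j)) (hC.strict j i (Ne.symm hij) h).le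

theorem IsIndexChain.isMarginalIndex {X : POArm M L} {F : Set (Set (X.State ω₀))}
    {C : X.State ω₀ → Set (X.State ω₀)} (hC : X.IsIndexChain β F C)
    (hF : X.PartialConservationLaw β F) (hβ0 : 0 ≤ β) (hβ1 : β < 1) :
    X.IsMarginalIndex β (X.chainIndex β C) := by
  have hcompl : ∀ i, {j | X.chainIndex β C i < X.chainIndex β C j} = (C i)ᶜ := fun i => by
    ext j
    simp [hC.mem_iff i j]
  refine ⟨fun i j h => ?_, fun i s => ?_, fun i => ?_, fun i => ?_⟩
  · by_contra hij
    rcases hC.chain.total i j hij with h' | h'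
    · exact (hC.strict i j hij h').ne h
    · exact (hC.strict j i (Ne.symm hij) h').ne h.symm
  · rw [hcompl, ← X.coeffA_eq_gap]
    exact hF.coeffA_nonneg hβ0 hβ1 (hC.chain.mem_family i) s
  · rw [hcompl, ← X.coeffA_eq_gap]
    exact hC.denom_ne_zero i
  · rw [hcompl, ← X.coeffA_eq_gap, ← X.coeffW_eq_gap]
    exact (div_mul_cancel₀ _ (hC.denom_ne_zero i)).symm

end POArm

/-! ### The advantage as a function of the subsidy -/

namespace POArm

variable {M L : ℕ} {X : POArm M L} {ω₀ : Belief M} {β : ℝ}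

/-- The total reward of a slot in the two-arm problem with subsidy `lam`. -/
def subsidizedReward (X : POArm M L) (lam : ℝ) (z : X.State ω₀ × Bool) : ℝ :=
  X.activeReward z - lam * X.activity z + lam

theorem isBdd_subsidizedReward (lam : ℝ) : IsBdd (X.subsidizedReward (ω₀ := ω₀) lam) :=
  (X.isBdd_activeReward.sub (X.isBdd_activity.const_mul lam)).add (.const lam)

theorem subsidizedReward_true (lam : ℝ) (s : X.State ω₀) :
    X.subsidizedReward lam (s, true) = X.reward s.1 := by
  simp [subsidizedReward, activeReward, activity]

theorem subsidizedReward_false (lam : ℝ) (s : X.State ω₀) :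
    X.subsidizedReward lam (s, false) = lam := by
  simp [subsidizedReward, activeReward, activity]

theorem value_eq_discounted (lam : ℝ) (π : X.Policy ω₀) (i : X.State ω₀) :
    X.value β lam π i = X.discounted β π i (X.subsidizedReward lam) := by
  rw [value]
  congr 1
  funext ⟨s, a⟩
  cases a <;> simp [subsidizedReward_true, subsidizedReward_false]

namespace IsMarginalIndex

variable {idx : X.State ω₀ → ℝ}

open Filter Topology

theorem gap_subsidizedReward_self (h : X.IsMarginalIndex β idx) (hβ0 : 0 ≤ β) (hβ1 : β < 1)
    (i : X.State ω₀) :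
    X.gap β {j | idx i < idx j} (X.subsidizedReward (idx i)) i = 0 := by
  have := X.gap_sub_const_mul hβ0 hβ1 {j | idx i < idx j} (idx i) X.isBdd_activeReward
    X.isBdd_activity i
  rw [h.reward_eq, sub_self] at this
  exact this

/-- At the subsidy `lam`, states of index `lam` may be added to the active set. -/
theorem gap_subsidizedReward_le_set (h : X.IsMarginalIndex β idx) (hβ0 : 0 ≤ β) (hβ1 : β < 1)
    (lam : ℝ) : X.gap β {j | lam ≤ idx j} (X.subsidizedReward lam) =
      X.gap β {j | lam < idx j} (X.subsidizedReward lam) := by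
  refine X.gap_congr hβ0 hβ1 (isBdd_subsidizedReward lam) fun s hs => ?_
  have hs' : lam = idx s := by
    simp only [Set.mem_ofPred_eq, not_iff, not_lt] at hs
    exact le_antisymm (by by_contra hlt; exact hlt (hs.1 (not_le.1 hlt).le)) (by
      by_contra hlt
      exact absurd (hs.2 (not_le.1 hlt).le) hlt)
  subst hs'
  exact h.gap_subsidizedReward_self hβ0 hβ1 s

/-- The active sets `{j | y < idx j}` are continuous from the right, while from the left they tend
to the set with `≤`; hence the two versions. -/
theorem eventually_right (lam : ℝ) (s : X.State ω₀) :
    ∀ᶠ y in 𝓝[>] lam, (s ∈ {j | y < idx j} ↔ s ∈ {j | lam < idx j}) := by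
  by_cases hs : lam < idx s
  · filter_upwards [Ioo_mem_nhdsGT hs] with y hy
    exact iff_of_true hy.2 hs
  · filter_upwards [self_mem_nhdsWithin] with y hy
    exact iff_of_false (fun h' => hs (lt_trans hy h')) hs

theorem eventually_left (lam : ℝ) (s : X.State ω₀) :
    ∀ᶠ y in 𝓝[<] lam, (s ∈ {j | y < idx j} ↔ s ∈ {j | lam ≤ idx j}) := by
  by_cases hs : lam ≤ idx s
  · filter_upwards [self_mem_nhdsWithin] with y hy
    exact iff_of_true (lt_of_lt_of_le hy hs) hs
  · filter_upwards [Ioo_mem_nhdsLT (not_le.1 hs)] with y hy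
    exact iff_of_false (not_lt.2 hy.1.le) hs

/-- The right limit is the value itself. The left limit belongs to the active set with `≤`, which at
the subsidy `lam` gives the same advantage. -/
theorem continuous_gap (h : X.IsMarginalIndex β idx) (hβ0 : 0 ≤ β) (hβ1 : β < 1)
    (i : X.State ω₀) :
    Continuous fun lam => X.gap β {j | lam < idx j} (X.subsidizedReward lam) i := by
  have hsplit : ∀ (D : Set (X.State ω₀)) (lam : ℝ), X.gap β D (X.subsidizedReward lam) i =
      X.gap β D X.activeReward i - lam * X.gap β D X.activity i := fun D lam =>
    X.gap_sub_const_mul hβ0 hβ1 D lam X.isBdd_activeReward X.isBdd_activity i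
  rw [continuous_iff_continuousAt]
  intro lam
  rw [continuousAt_iff_continuous_left'_right']
  constructor
  · rw [ContinuousWithinAt, ← h.gap_subsidizedReward_le_set hβ0 hβ1 lam]
    simp only [hsplit]
    exact (X.tendsto_gap hβ0 hβ1 (eventually_left lam) X.isBdd_activeReward i).sub
      ((tendsto_id.mono_left nhdsWithin_le_nhds).mul
        (X.tendsto_gap hβ0 hβ1 (eventually_left lam) X.isBdd_activity i))
  · rw [ContinuousWithinAt]
    simp only [hsplit]
    exact (X.tendsto_gap hβ0 hβ1 (eventually_right lam) X.isBdd_activeReward i).sub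
      ((tendsto_id.mono_left nhdsWithin_le_nhds).mul
        (X.tendsto_gap hβ0 hβ1 (eventually_right lam) X.isBdd_activity i))

/-- Marginal active times are nonnegative for all the sets cut out by the index. -/
theorem gap_activity_nonneg (h : X.IsMarginalIndex β idx) (hβ0 : 0 ≤ β) (hβ1 : β < 1) (lam : ℝ)
    (i : X.State ω₀) : 0 ≤ X.gap β {j | lam < idx j} X.activity i := by
  -- If some index is largest among those at most `lam`, the active set is the one cut out at that
  -- index.
  by_cases hmax : ∃ k, idx k ≤ lam ∧ ∀ s, idx s ≤ lam → idx s ≤ idx k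
  · obtain ⟨k, hk, hmax⟩ := hmax
    have : {j | lam < idx j} = {j | idx k < idx j} := by
      ext j
      exact ⟨fun hj => lt_of_le_of_lt hk hj, fun hj => by
        by_contra hle
        exact absurd (hmax j (not_lt.1 hle)) (not_le.2 hj)⟩
    rw [this]
    exact h.nonneg k i
  push Not at hmax
  by_cases hne : ∃ k, idx k ≤ lam
  · obtain ⟨k₀, hk₀⟩ := hne
    have hbdd : BddAbove (idx '' {s | idx s ≤ lam}) := ⟨lam, by rintro _ ⟨s, hs, rfl⟩; exact hs⟩
    -- No index is largest below `lam`, so the supremum is not attained. Along indices tending to it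
    -- the active sets converge pointwise to the one at `lam`, and nonnegativity passes to the
    -- limit.
    obtain ⟨u, -, hu, hmem⟩ := exists_seq_tendsto_sSup (⟨_, k₀, hk₀, rfl⟩ :
      (idx '' {s | idx s ≤ lam}).Nonempty) hbdd
    choose k hk hku using hmem
    have hD : ∀ s, ∀ᶠ n in atTop, (s ∈ {j | idx (k n) < idx j} ↔ s ∈ {j | lam < idx j}) := by
      intro s
      by_cases hs : lam < idx s
      · exact Eventually.of_forall fun n => iff_of_true (lt_of_le_of_lt (hk n) hs) hs
      · obtain ⟨k', hk', hlt⟩ := hmax s (not_lt.1 hs)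
        have hsup : idx s < sSup (idx '' {s | idx s ≤ lam}) :=
          hlt.trans_le (le_csSup hbdd ⟨k', hk', rfl⟩)
        filter_upwards [hu.eventually_const_lt hsup] with n hn
        rw [← hku n] at hn
        exact iff_of_false (not_lt.2 hn.le) hs
    exact ge_of_tendsto' (X.tendsto_gap hβ0 hβ1 hD X.isBdd_activity i) fun n => h.nonneg (k n) i
  · push Not at hne
    have huniv : {j | lam < idx j} = Set.univ := Set.eq_univ_of_forall hne
    have hV : ∀ j : X.State ω₀, X.discounted β (X.priorityPolicy Set.univ) j X.activity = 1 / (1 - β) := by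
      intro j
      rw [← X.discounted_const (X.priorityPolicy Set.univ) j hβ0 hβ1]
      refine X.discounted_congr _ j hβ0 hβ1 X.isBdd_activity (.const 1) fun past s a ha => ?_
      simp [activity, (X.priorityPolicy_ne_zero ha).2 (Set.mem_univ s)]
    simp only [huniv, gap, hV, X.nextValue_const]
    simp [activity]

/-- To the right of a value that is not a limit point of the index, the active set is locally
constant. -/
theorem eventually_activeSet_eq {lam : ℝ}
    (hlam : ¬MapClusterPt lam cofinite idx) :
    ∀ᶠ y in 𝓝[>] lam, {j | y < idx j} = {j | lam < idx j} := by
  rw [mapClusterPt_iff_frequently] at hlam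
  push Not at hlam
  obtain ⟨U, hU, hfin⟩ := hlam
  simp only [eventually_cofinite, not_not] at hfin
  obtain ⟨ε, hε, hball⟩ := Metric.mem_nhds_iff.1 hU
  -- Only finitely many states have an index near `lam`, so `y` can be taken below every such index
  -- that exceeds `lam`.
  have hall := (eventually_all_finite hfin).2 fun s _ => eventually_right (idx := idx) lam s
  filter_upwards [hall, Ioo_mem_nhdsGT (show lam < lam + ε by linarith)] with y hy hlamy
  ext s
  refine ⟨fun hs => hlamy.1.trans hs, fun hs => ?_⟩
  by_contra hle
  have hs' : lam < idx s := hs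
  have hle' : idx s ≤ y := not_lt.1 hle
  refine hle ((hy s (hball ?_)).2 hs)
  rw [Metric.mem_ball, Real.dist_eq, abs_lt]
  constructor <;> linarith [hlamy.2]

theorem antitone_gap (h : X.IsMarginalIndex β idx) (hβ0 : 0 ≤ β) (hβ1 : β < 1)
    (hlim : FinitelyManyLimitPoints idx) (i : X.State ω₀) :
    Antitone fun lam => X.gap β {j | lam < idx j} (X.subsidizedReward lam) i := by
  refine antitone_of_eventually_le_right (h.continuous_gap hβ0 hβ1 i) hlim.countable fun x hx => ?_
  filter_upwards [eventually_activeSet_eq hx, self_mem_nhdsWithin] with y hy hxy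
  have hsplit := fun lam => X.gap_sub_const_mul hβ0 hβ1 {j | x < idx j} lam X.isBdd_activeReward
    X.isBdd_activity i
  simp only [hy]
  unfold subsidizedReward
  rw [hsplit, hsplit]
  exact sub_le_sub_left (mul_le_mul_of_nonneg_right (le_of_lt hxy)
    (h.gap_activity_nonneg hβ0 hβ1 x i)) _

theorem gap_subsidizedReward_nonneg (h : X.IsMarginalIndex β idx) (hβ0 : 0 ≤ β) (hβ1 : β < 1)
    (hlim : FinitelyManyLimitPoints idx) {lam : ℝ} {i : X.State ω₀} (hi : lam ≤ idx i) :
    0 ≤ X.gap β {j | lam < idx j} (X.subsidizedReward lam) i := by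
  rw [← h.gap_subsidizedReward_self hβ0 hβ1 i]
  exact h.antitone_gap hβ0 hβ1 hlim i hi

theorem gap_subsidizedReward_nonpos (h : X.IsMarginalIndex β idx) (hβ0 : 0 ≤ β) (hβ1 : β < 1)
    (hlim : FinitelyManyLimitPoints idx) {lam : ℝ} {i : X.State ω₀} (hi : idx i ≤ lam) :
    X.gap β {j | lam < idx j} (X.subsidizedReward lam) i ≤ 0 := by
  rw [← h.gap_subsidizedReward_self hβ0 hβ1 i]
  exact h.antitone_gap hβ0 hβ1 hlim i hi

/-- By injectivity the sets with `<` and `≤` differ only in `i`. If the marginal active time in `i`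
vanished for one, passing to the other would not change it. -/
theorem gap_activity_le_set_ne_zero (h : X.IsMarginalIndex β idx) (hβ0 : 0 ≤ β) (hβ1 : β < 1)
    (i : X.State ω₀) : X.gap β {j | idx i ≤ idx j} X.activity i ≠ 0 := by
  intro h0
  refine h.ne_zero i ?_
  rw [X.gap_congr hβ0 hβ1 (D := {j | idx i ≤ idx j}) X.isBdd_activity, h0]
  intro s hs
  have hs' : s = i := by
    by_contra hne
    refine hs ⟨fun hle => lt_of_le_of_ne hle fun he => hne (h.injective he.symm), fun hlt => ?_⟩
    exact (show idx i < idx s from hlt).le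
  rw [hs', h0]

/-- Monotonicity alone allows the advantage to vanish on an interval below the index; the nonzero
denominator excludes this. -/
theorem gap_subsidizedReward_pos (h : X.IsMarginalIndex β idx) (hβ0 : 0 ≤ β) (hβ1 : β < 1)
    (hlim : FinitelyManyLimitPoints idx) {lam : ℝ} {i : X.State ω₀} (hi : lam < idx i) :
    0 < X.gap β {j | lam < idx j} (X.subsidizedReward lam) i := by
  refine lt_of_le_of_ne (h.gap_subsidizedReward_nonneg hβ0 hβ1 hlim hi.le) fun h0 => ?_
  have hzero : ∀ y, lam ≤ y → y ≤ idx i →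
      X.gap β {j | y < idx j} (X.subsidizedReward y) i = 0 := fun y hy hyi =>
    le_antisymm ((h.antitone_gap hβ0 hβ1 hlim i hy).trans h0.symm.le)
      (h.gap_subsidizedReward_nonneg hβ0 hβ1 hlim hyi)
  -- Two nearby subsidies share their active set, and the affine advantage vanishes at both, so its
  -- slope is zero.
  have hA : ∀ x ∈ Set.Ioo lam (idx i), ¬MapClusterPt x cofinite idx →
      X.gap β {j | x < idx j} X.activity i = 0 := by
    intro x hx hxl
    obtain ⟨y, hy, hxy, hyi⟩ :=
      ((eventually_activeSet_eq hxl).and (Ioo_mem_nhdsGT hx.2)).exists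
    have hsplit := fun lam => X.gap_sub_const_mul hβ0 hβ1 {j | x < idx j} lam X.isBdd_activeReward
      X.isBdd_activity i
    have h1 := hzero x hx.1.le hx.2.le
    have h2 := hzero y (hx.1.trans hxy).le hyi.le
    rw [hy] at h2
    unfold subsidizedReward at h1 h2
    rw [hsplit] at h1 h2
    have h3 : (y - x) * X.gap β {j | x < idx j} X.activity i = 0 := by linarith
    exact (mul_eq_zero.1 h3).resolve_left (sub_ne_zero.2 hxy.ne')
  -- Since there are finitely many limit points, none lies just to the left of `idx i`, even if `idx
  -- i` is one itself.
  have hnot : ∀ᶠ x in 𝓝[<] idx i, ¬MapClusterPt x cofinite idx := by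
    have hfin : ({v | MapClusterPt v cofinite idx} \ {idx i}).Finite := hlim.subset Set.sdiff_subset
    filter_upwards [self_mem_nhdsWithin, mem_nhdsWithin_of_mem_nhds
      (hfin.isClosed.isOpen_compl.mem_nhds fun hm => hm.2 rfl)] with x hx hx' hcl
    exact hx' ⟨hcl, (ne_of_lt hx : x ≠ idx i)⟩
  have hlimit := X.tendsto_gap hβ0 hβ1 (eventually_left (idx := idx) (idx i)) X.isBdd_activity i
  refine h.gap_activity_le_set_ne_zero hβ0 hβ1 i (tendsto_nhds_unique hlimit ?_)
  refine tendsto_const_nhds.congr' ?_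
  filter_upwards [hnot, Ioo_mem_nhdsLT hi] with x hx hx'
  exact (hA x hx' hx).symm

/-! ### Optimal policies and passive sets -/

theorem deviation_nonpos (h : X.IsMarginalIndex β idx) (hβ0 : 0 ≤ β) (hβ1 : β < 1)
    (hlim : FinitelyManyLimitPoints idx) (lam : ℝ) (z : X.State ω₀ × Bool) :
    X.deviation β {j | lam < idx j} (X.subsidizedReward lam) z ≤ 0 := by
  rw [deviation]
  split_ifs with ha hs hs
  · rfl
  · exact h.gap_subsidizedReward_nonpos hβ0 hβ1 hlim (not_lt.1 hs)
  · exact neg_nonpos.2 (h.gap_subsidizedReward_nonneg hβ0 hβ1 hlim (le_of_lt hs))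
  · rfl

theorem value_le (h : X.IsMarginalIndex β idx) (hβ0 : 0 ≤ β) (hβ1 : β < 1)
    (hlim : FinitelyManyLimitPoints idx) (lam : ℝ) (π : X.Policy ω₀) (i : X.State ω₀) :
    X.value β lam π i ≤ X.value β lam (X.priorityPolicy {j | lam < idx j}) i := by
  have hb := isBdd_subsidizedReward (X := X) (ω₀ := ω₀) lam
  rw [value_eq_discounted, value_eq_discounted,
    X.discounted_eq_add_deviation hβ0 hβ1 {j | lam < idx j} π i hb, add_le_iff_nonpos_right]
  calc _ ≤ X.discounted β π i fun _ => 0 :=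
        X.discounted_mono π i hβ0 hβ1 (X.isBdd_deviation hβ0 hβ1 _ hb) (.const 0)
          fun _ s a _ => h.deviation_nonpos hβ0 hβ1 hlim lam (s, a)
    _ = 0 := by rw [X.discounted_const π i hβ0 hβ1, zero_div]

theorem isOptimalFrom (h : X.IsMarginalIndex β idx) (hβ0 : 0 ≤ β) (hβ1 : β < 1)
    (hlim : FinitelyManyLimitPoints idx) {lam : ℝ} {π : X.Policy ω₀}
    (hπ : X.IsIndexPriorityPolicy idx lam π) (i : X.State ω₀) : X.IsOptimalFrom β lam π i := by
  intro π'
  refine (h.value_le hβ0 hβ1 hlim lam π' i).trans_eq ?_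
  have hb := isBdd_subsidizedReward (X := X) (ω₀ := ω₀) lam
  rw [value_eq_discounted, value_eq_discounted,
    X.discounted_eq_add_deviation hβ0 hβ1 {j | lam < idx j} π i hb, left_eq_add,
    X.discounted_congr π i hβ0 hβ1 (X.isBdd_deviation hβ0 hβ1 _ hb) (.const 0),
    X.discounted_const π i hβ0 hβ1, zero_div]
  intro past s a ha
  -- The policy follows the active set off ties, and at a tie `idx s = lam` the advantage is zero,
  -- so either action is free.
  rcases lt_trichotomy lam (idx s) with hs | hs | hs
  · rw [hπ.1 past s hs] at ha
    cases a
    · simp at ha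
    · simp [deviation, hs]
  · have h0 := h.gap_subsidizedReward_self hβ0 hβ1 s
    rw [← hs] at h0
    simp [deviation, ← hs, h0]
  · rw [hπ.2 past s hs] at ha
    cases a
    · simp [deviation, hs.le]
    · simp at ha

theorem passiveSet_eq (h : X.IsMarginalIndex β idx) (hβ0 : 0 ≤ β) (hβ1 : β < 1)
    (hlim : FinitelyManyLimitPoints idx) (lam : ℝ) :
    X.passiveSet β ω₀ lam = {i | idx i ≤ lam} := by
  ext i
  constructor
  · rintro ⟨π, hπ, hopt⟩
    by_contra hi
    have hi' : lam < idx i := not_le.1 hi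
    have hb := isBdd_subsidizedReward (X := X) (ω₀ := ω₀) lam
    have hle := hopt (X.priorityPolicy {j | lam < idx j})
    rw [value_eq_discounted, value_eq_discounted,
      X.discounted_eq_add_deviation hβ0 hβ1 {j | lam < idx j} π i hb,
      le_add_iff_nonneg_right] at hle
    -- No deviation gains anything, so the loss from resting in the first slot, which is the
    -- advantage in `i`, is never recovered.
    have hfirst := X.le_discounted_of_nonneg π i hβ0 hβ1
      ((X.isBdd_deviation hβ0 hβ1 {j | lam < idx j} hb).const_mul (-1))
      (fun _ s a _ => by linarith [h.deviation_nonpos hβ0 hβ1 hlim lam (s, a)]) hπ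
    rw [X.discounted_const_mul] at hfirst
    have hdev : X.deviation β {j | lam < idx j} (X.subsidizedReward lam) (i, false) =
        -X.gap β {j | lam < idx j} (X.subsidizedReward lam) i := by
      simp [deviation, hi']
    rw [hdev] at hfirst
    linarith [h.gap_subsidizedReward_pos hβ0 hβ1 hlim hi']
  · intro hi
    refine ⟨X.priorityPolicy {j | lam < idx j}, ?_, fun π' => h.value_le hβ0 hβ1 hlim lam π' i⟩
    simp [priorityPolicy, show ¬lam < idx i from not_lt.2 hi]

end IsMarginalIndex

/-! ### Extreme subsidies -/

/-- Reward bounds give a threshold uniform in the state, whereas the form of the passive set found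
above would require a lower bound on the indices. -/
theorem eventually_passiveSet_eq_empty (hβ0 : 0 ≤ β) (hβ1 : β < 1) :
    ∀ᶠ lam in Filter.atBot, X.passiveSet β ω₀ lam = ∅ := by
  obtain ⟨B, hB⟩ := X.isBdd_activeReward (ω₀ := ω₀)
  have hr : ∀ s : X.State ω₀, |X.reward s.1| ≤ B := fun s => by
    simpa [activeReward] using hB (s, true)
  -- For `lam ≤ B`, resting first earns at most `lam - B + B / (1 - β)`, and permanent activity
  -- earns at least `-B / (1 - β)`. The first threshold makes the former smaller.
  filter_upwards [Filter.eventually_lt_atBot (B - B / (1 - β) - B / (1 - β)),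
    Filter.eventually_le_atBot B] with lam h1 h2
  refine Set.eq_empty_of_forall_notMem ?_
  rintro i ⟨π, hπ, hopt⟩
  have hb := isBdd_subsidizedReward (X := X) (ω₀ := ω₀) lam
  have hle := hopt (X.priorityPolicy Set.univ)
  rw [value_eq_discounted, value_eq_discounted] at hle
  have hlow : -B / (1 - β) ≤
      X.discounted β (X.priorityPolicy Set.univ) i (X.subsidizedReward lam) := by
    rw [← X.discounted_const (X.priorityPolicy Set.univ) i hβ0 hβ1]
    refine X.discounted_mono _ i hβ0 hβ1 (.const _) hb fun past s a ha => ?_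
    rw [(X.priorityPolicy_ne_zero ha).2 (Set.mem_univ s), subsidizedReward_true]
    exact (abs_le.1 (hr s)).1
  have hfirst := X.le_discounted_of_nonneg π i hβ0 hβ1 ((IsBdd.const B).sub hb)
    (fun _ s a _ => by
      cases a
      · rw [subsidizedReward_false]; linarith
      · rw [subsidizedReward_true]; linarith [(abs_le.1 (hr s)).2]) hπ
  rw [X.discounted_sub π i hβ0 hβ1 (.const B) hb, X.discounted_const π i hβ0 hβ1,
    subsidizedReward_false] at hfirst
  rw [neg_div] at hlow
  linarith

theorem eventually_passiveSet_eq_univ (hβ0 : 0 ≤ β) (hβ1 : β < 1) :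
    ∀ᶠ lam in Filter.atTop, X.passiveSet β ω₀ lam = Set.univ := by
  obtain ⟨B, hB⟩ := X.isBdd_activeReward (ω₀ := ω₀)
  have hr : ∀ s : X.State ω₀, |X.reward s.1| ≤ B := fun s => by
    simpa [activeReward] using hB (s, true)
  filter_upwards [Filter.eventually_ge_atTop B] with lam hlam
  refine Set.eq_univ_of_forall fun i => ⟨X.priorityPolicy ∅, by simp [priorityPolicy], ?_⟩
  intro π
  have hb := isBdd_subsidizedReward (X := X) (ω₀ := ω₀) lam
  rw [value_eq_discounted, value_eq_discounted]
  have h1 : X.discounted β (X.priorityPolicy ∅) i (X.subsidizedReward lam) = lam / (1 - β) := by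
    rw [← X.discounted_const (X.priorityPolicy ∅) i hβ0 hβ1]
    refine X.discounted_congr _ i hβ0 hβ1 hb (.const _) fun past s a ha => ?_
    have := X.priorityPolicy_ne_zero ha
    cases a
    · rw [subsidizedReward_false]
    · simp at this
  rw [h1, ← X.discounted_const π i hβ0 hβ1]
  refine X.discounted_mono π i hβ0 hβ1 hb (.const _) fun past s a _ => ?_
  cases a
  · rw [subsidizedReward_false]
  · rw [subsidizedReward_true]
    exact (abs_le.1 (hr s)).2.trans hlam

/-! ### Whittle indexability -/

theorem IsMarginalIndex.whittleIndexable {idx : X.State ω₀ → ℝ} (h : X.IsMarginalIndex β idx)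
    (hβ0 : 0 ≤ β) (hβ1 : β < 1) (hlim : FinitelyManyLimitPoints idx) :
    X.WhittleIndexable β ω₀ where
  mono lam lam' hle := by
    rw [h.passiveSet_eq hβ0 hβ1 hlim, h.passiveSet_eq hβ0 hβ1 hlim]
    exact fun i hi => le_trans hi hle
  eventually_empty := eventually_passiveSet_eq_empty hβ0 hβ1
  eventually_univ := eventually_passiveSet_eq_univ hβ0 hβ1

theorem IsMarginalIndex.isWhittleIndex {idx : X.State ω₀ → ℝ} (h : X.IsMarginalIndex β idx)
    (hβ0 : 0 ≤ β) (hβ1 : β < 1) (hlim : FinitelyManyLimitPoints idx) (i : X.State ω₀) :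
    X.IsWhittleIndex β i (idx i) := by
  simp only [IsWhittleIndex, h.passiveSet_eq hβ0 hβ1 hlim]
  exact isGLB_Ici

end POArm

end

theorem theorem3 {N : ℕ} {M L : Fin N → ℕ} (arm : ∀ n, POArm (M n) (L n))
    (β : ℝ) (hβ0 : 0 ≤ β) (hβ1 : β < 1) (ω₀ : ∀ n, Belief (M n))
    (F : ∀ n, Set (Set ((arm n).State (ω₀ n))))
    (hPCL : ∀ n, (arm n).PCLIndexable β (F n))
    -- `C n` is the unique chain provided by PCL-indexability
    (C : ∀ n, (arm n).State (ω₀ n) → Set ((arm n).State (ω₀ n)))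
    (hC : ∀ n, (arm n).IsIndexChain β (F n) (C n))
    (hlim : ∀ n, POArm.FinitelyManyLimitPoints ((arm n).chainIndex β (C n))) :
    (∀ n lam π, (arm n).IsIndexPriorityPolicy ((arm n).chainIndex β (C n)) lam π →
      ∀ i, (arm n).IsOptimalFrom β lam π i) ∧
    RMABWhittleIndexable arm β ω₀ ∧
    ∀ n i, (arm n).IsWhittleIndex β i ((arm n).chainIndex β (C n) i) := by
  have hidx n := (hC n).isMarginalIndex (hPCL n).pcl hβ0 hβ1
  exact ⟨fun n _ _ hπ i => (hidx n).isOptimalFrom hβ0 hβ1 (hlim n) hπ i,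
    fun n => (hidx n).whittleIndexable hβ0 hβ1 (hlim n),
    fun n i => (hidx n).isWhittleIndex hβ0 hβ1 (hlim n) i⟩
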